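/- Let $d\ge 1$, $\lambda\ge 0$, $r>0$ and let $p:\mathbb N_0\to[0,1]$. Let $X$ be a homogeneous Poisson point process of intensity $\lambda$ on $\mathbb R^d$ (a random locally finite counting measure whose counts on disjoint bounded Borel sets $B$ are independent and $\mathrm{Poisson}(\lambda|B|)$ distributed, $|B|$ being Lebesgue measure). Write $X=\sum_{i<\kappa}\delta_{\xi_i}$ for a measurable enumeration of its points (with $\kappa\in\{0,1,\dots,\infty\}$ random), and let $U_0,U_1,\dots$ be independent $\mathrm{Uniform}(0,1)$ marks that are independent of $(\kappa,\xi_0,\xi_1,\dots)$. For $x\in\mathbb R^d$ let $n_r(x;X)=X(B(x,r)\setminus\{x\})$ be the number of points of $X$ other than $x$ in the closed Euclidean ball $B(x,r)$. Let $v_d$ be the volume of the unit ball of $\mathbb R^d$ and put $$\mu:=\lambda v_d r^d,\qquad m_p:=\mathbb E[p(N)],\qquad N\sim\mathrm{Poisson}(\mu).$$ Define, with the same marks, the neighbour-count dependent thinning and the independent $m_p$-thinning $$T_r(X):=\sum_{i<\kappa}\mathbf 1\{U_i\le p(n_r(\xi_i;X))\}\,\delta_{\xi_i},\qquad \Pi_{\mathrm{ind}}:=\sum_{i<\kappa}\mathbf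 1\{U_i\le m_p\}\,\delta_{\xi_i}.$$ Then $T_r(X)$ is a point process, $\Pi_{\mathrm{ind}}$ is a homogeneous Poisson point process of intensity $\lambda m_p$, and for every bounded Borel set $W\subset\mathbb R^d$ $$d_{\mathrm{TV}}\Big(\mathcal L\big(T_r(X)|_W\big),\,\mathcal L\big(\Pi_{\mathrm{ind}}|_W\big)\Big)\ \le\ \lambda\,|W|\,\mathbb E\big|p(N)-m_p\big| ,$$ where $d_{\mathrm{TV}}(P,Q)=\sup_A|P(A)-Q(A)|$, the supremum being over all events $A$ of the $\sigma$-algebra generated by the counts of Borel sets. -/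

import Mathlib

open MeasureTheory ProbabilityTheory Metric
open scoped NNReal ENNReal

namespace NeighbourThinning

/-- `ℝ^d` with the Euclidean norm. -/
abbrev Space (d : ℕ) : Type := EuclideanSpace ℝ (Fin d)

/-- `μ` is a locally finite counting measure: it takes a (finite) natural number as its value on
every bounded Borel set. -/
def IsConfiguration {d : ℕ} (μ : Measure (Space d)) : Prop :=
  ∀ B : Set (Space d), MeasurableSet B → Bornology.IsBounded B → ∃ n : ℕ, μ B = n

/-- A point process: a random element of the space of locally finite counting measures.
`Measure (Space d)` carries the σ-algebra generated by the evaluations `μ ↦ μ B`, `B` Borel. -/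
structure IsPointProcess {d : ℕ} {Ω : Type*} [MeasurableSpace Ω]
    (X : Ω → Measure (Space d)) : Prop where
  measurable : Measurable X
  isConfiguration : ∀ ω, IsConfiguration (X ω)

/-- `X ∼ PPP(Λ)`: the counts of `X` in disjoint bounded Borel sets are independent, and the count
in `B` is Poisson distributed with mean `Λ B`. -/
structure IsPoissonProcess {d : ℕ} {Ω : Type*} [MeasurableSpace Ω]
    (X : Ω → Measure (Space d)) (Λ : Measure (Space d)) [IsLocallyFiniteMeasure Λ]
    (P : Measure Ω) : Prop extends IsPointProcess X where
  hasLaw : ∀ B : Set (Space d), MeasurableSet B → Bornology.IsBounded B →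
    HasLaw (fun ω => X ω B)
      ((poissonMeasure (Λ B).toNNReal).map (fun n : ℕ => (n : ℝ≥0∞))) P
  indep : ∀ (k : ℕ) (A : Fin k → Set (Space d)),
    (∀ i, MeasurableSet (A i)) → (∀ i, Bornology.IsBounded (A i)) →
    Pairwise (fun i j => Disjoint (A i) (A j)) →
    iIndepFun (fun i ω => X ω (A i)) P

/-- The counting measure `∑_{i < k} δ_{x i}` of a finite or infinite list of points. -/
noncomputable def pointSum {d : ℕ} (k : ℕ∞) (x : ℕ → Space d) : Measure (Space d) :=
  Measure.sum fun i : ℕ => if (i : ℕ∞) < k then Measure.dirac (x i) else 0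

/-- The points of `X`, enumerated measurably as `ξ 0, ξ 1, …` (`κ` many of them), carry marks
`U 0, U 1, …` which are independent, uniform on `(0,1)`, and independent of the points. -/
structure IsUniformMarking {d : ℕ} {Ω : Type*} [MeasurableSpace Ω]
    (X : Ω → Measure (Space d)) (κ : Ω → ℕ∞) (ξ : ℕ → Ω → Space d) (U : ℕ → Ω → ℝ)
    (P : Measure Ω) : Prop where
  measurable_card : Measurable κ
  measurable_point : ∀ i, Measurable (ξ i)
  measurable_mark : ∀ i, Measurable (U i)
  eq_pointSum : ∀ ω, X ω = pointSum (κ ω) (fun i => ξ i ω)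
  hasLaw_mark : ∀ i, HasLaw (U i) (volume.restrict (Set.Ioo (0 : ℝ) 1)) P
  iIndepFun_mark : iIndepFun U P
  indepFun : IndepFun (fun ω i => U i ω) (fun ω => (κ ω, fun i => ξ i ω)) P

/-- Thinning of the marked points `(x i, u i)`, `i < k`: the point `x i` is retained if and only
if `u i ≤ q (x i)`. -/
noncomputable def thinning {d : ℕ} (k : ℕ∞) (x : ℕ → Space d) (u : ℕ → ℝ) (q : Space d → ℝ) :
    Measure (Space d) :=
  Measure.sum fun i : ℕ =>
    if (i : ℕ∞) < k ∧ u i ≤ q (x i) then Measure.dirac (x i) else 0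

/-- `n_r(x; μ)`: the number of points of the configuration `μ` in the closed ball `B(x,r)` other
than `x`. (The measure of the set is a natural number, so the floor only changes its type.) -/
noncomputable def neighbourCount {d : ℕ} (r : ℝ) (x : Space d) (μ : Measure (Space d)) : ℕ :=
  ⌊(μ (closedBall x r \ {x})).toReal⌋₊

/-- The neighbour-count dependent thinning `T_r(X)` built from the marked points of `X`. -/
noncomputable def neighbourThinning {d : ℕ} {Ω : Type*} (r : ℝ) (p : ℕ → ℝ)
    (X : Ω → Measure (Space d)) (κ : Ω → ℕ∞) (ξ : ℕ → Ω → Space d) (U : ℕ → Ω → ℝ) :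
    Ω → Measure (Space d) :=
  fun ω => thinning (κ ω) (fun i => ξ i ω) (fun i => U i ω)
    (fun x => p (neighbourCount r x (X ω)))

/-- The independent thinning with constant retention probability `m`, built from the same
marked points. -/
noncomputable def independentThinning {d : ℕ} {Ω : Type*} (m : ℝ)
    (κ : Ω → ℕ∞) (ξ : ℕ → Ω → Space d) (U : ℕ → Ω → ℝ) :
    Ω → Measure (Space d) :=
  fun ω => thinning (κ ω) (fun i => ξ i ω) (fun i => U i ω) (fun _ => m)

/-- `μ = lam * v_d * r ^ d`, where `v_d` is the volume of the unit ball of `ℝ^d`. -/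
noncomputable def meanCount (d : ℕ) (lam : ℝ≥0) (r : ℝ) : ℝ≥0 :=
  lam * (volume (closedBall (0 : Space d) 1)).toNNReal * r.toNNReal ^ d

/-- `m_p = E[p(N)]`, `N ∼ Poisson(μ)`. -/
noncomputable def meanRetention (p : ℕ → ℝ) (μ : ℝ≥0) : ℝ :=
  ∫ n, p n ∂(poissonMeasure μ)

/-- Total variation distance `sup_A |P(A) - Q(A)|` of probability laws. -/
noncomputable def tvDist {M : Type*} [MeasurableSpace M] (P Q : Measure M) : ℝ :=
  ⨆ A : {A : Set M // MeasurableSet A}, |P.real A.1 - Q.real A.1|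

/-- The law of the restriction of `Y` to the window `W`, as a law on counting measures on `W`
(the events of counting measures on `W` are the traces of the events of `Measure (Space d)`). -/
noncomputable def windowLaw {d : ℕ} {Ω : Type*} [MeasurableSpace Ω] (P : Measure Ω)
    (Y : Ω → Measure (Space d)) (W : Set (Space d)) : Measure (Measure (Space d)) :=
  P.map (fun ω => (Y ω).restrict W)

/-- Auxiliary to `exists_measurable_enumeration`: an order of the points of space in which every
locally finite configuration can be listed. -/
theorem exists_linearising_embedding (d : ℕ) :
    ∃ g : Space d → ℝ, MeasurableEmbedding g ∧ (∀ x, 0 ≤ g x) ∧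
      ∀ t : ℝ, Bornology.IsBounded (g ⁻¹' Set.Iic t) := by
  obtain ⟨f, hf⟩ := exists_measurableEmbedding_real (Space d)
  have h0 : ∀ y : ℝ, 0 < Real.sigmoid y := Real.sigmoid_pos
  have h1 : ∀ y : ℝ, Real.sigmoid y < 1 := Real.sigmoid_lt_one
  refine ⟨fun x => (⌊‖x‖⌋₊ : ℝ) + Real.sigmoid (f x), ?_, ?_, ?_⟩
  · apply Measurable.measurableEmbedding
    · have := hf.measurable
      have h2 : Measurable fun x : Space d => (⌊‖x‖⌋₊ : ℝ) :=
        (measurable_from_nat (f := fun n : ℕ => (n : ℝ))).comp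
          (Nat.measurable_floor.comp measurable_norm)
      exact h2.add (continuous_sigmoid.measurable.comp this)
    · intro x y hxy
      simp only at hxy
      have ha : ⌊‖x‖⌋₊ = ⌊‖y‖⌋₊ := by
        rcases lt_trichotomy ⌊‖x‖⌋₊ ⌊‖y‖⌋₊ with h | h | h
        · have : (⌊‖x‖⌋₊ : ℝ) + 1 ≤ ⌊‖y‖⌋₊ := by exact_mod_cast h
          linarith [h0 (f y), h1 (f x)]
        · exact h
        · have : (⌊‖y‖⌋₊ : ℝ) + 1 ≤ ⌊‖x‖⌋₊ := by exact_mod_cast h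
          linarith [h0 (f x), h1 (f y)]
      rw [ha] at hxy
      exact hf.injective (Real.sigmoid_injective (by linarith))
  · intro x
    have := h0 (f x)
    positivity
  · intro t
    refine (Metric.isBounded_closedBall (x := (0 : Space d)) (r := t + 1)).subset ?_
    intro x hx
    simp only [Set.mem_preimage, Set.mem_Iic] at hx
    rw [mem_closedBall_zero_iff]
    have := Nat.lt_floor_add_one ‖x‖
    linarith [h0 (f x)]

/-- Every locally finite counting measure is the sum of the Dirac measures at points that are
listed measurably, so that every point process has a measurable enumeration. -/
theorem exists_measurable_enumeration (d : ℕ) :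
    ∃ (κ : Measure (Space d) → ℕ∞) (ξ : ℕ → Measure (Space d) → Space d),
      Measurable κ ∧ (∀ i, Measurable (ξ i)) ∧
      ∀ μ, IsConfiguration μ → μ = pointSum (κ μ) (fun i => ξ i μ) := by
  obtain ⟨g, hg, hg0, hgb⟩ := exists_linearising_embedding d
  let F : Measure (Space d) → ℝ → ℝ≥0∞ := fun μ t => μ (g ⁻¹' Set.Iic t)
  have hFm : ∀ t, Measurable fun μ => F μ t := fun t =>
    Measure.measurable_coe (hg.measurable measurableSet_Iic)
  let T : ℕ → Measure (Space d) → EReal := fun j μ =>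
    ⨅ q : ℚ, if ((j : ℝ≥0∞) + 1) ≤ F μ q then ((q : ℝ) : EReal) else ⊤
  have hTm : ∀ j, Measurable (T j) := fun j => Measurable.iInf fun q =>
    Measurable.ite (measurableSet_le measurable_const (hFm q)) measurable_const measurable_const
  obtain ⟨h, hh, hhg⟩ : ∃ h : ℝ → Space d, Measurable h ∧ ∀ x, h (g x) = x := by
    obtain ⟨h, hh, e⟩ := hg.exists_measurable_extend measurable_id (fun _ => ⟨0⟩)
    exact ⟨h, hh, fun x => congrFun e x⟩
  let c : ℝ≥0∞ → ℕ∞ := fun a => if a = ⊤ then ⊤ else ((⌊a.toReal⌋₊ : ℕ) : ℕ∞)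
  have hc : Measurable c := Measurable.ite (measurableSet_singleton _) measurable_const
    ((measurable_from_nat (f := fun n : ℕ => (n : ℕ∞))).comp
      (Nat.measurable_floor.comp ENNReal.measurable_toReal))
  refine ⟨fun μ => c (μ Set.univ), fun j μ => h (T j μ).toReal,
    hc.comp (Measure.measurable_coe MeasurableSet.univ),
    fun j => hh.comp ((measurable_ereal_toReal).comp (hTm j)), ?_⟩
  intro μ hμ
  have hcard : ∀ j : ℕ, (j : ℕ∞) < c (μ Set.univ) ↔ (j : ℝ≥0∞) + 1 ≤ μ Set.univ := by
    intro j
    by_cases ht : μ Set.univ = ⊤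
    · simp [c, ht]
    · simp only [c, ht, if_false, Nat.cast_lt]
      rw [Nat.lt_iff_add_one_le, Nat.le_floor_iff ENNReal.toReal_nonneg]
      rw [← ENNReal.ofReal_le_iff_le_toReal ht, ENNReal.ofReal_natCast]
      push_cast
      rfl
  have hFfin : ∀ t, F μ t ≠ ⊤ := fun t => by
    obtain ⟨n, hn⟩ := hμ _ (hg.measurable measurableSet_Iic) (hgb t)
    simp [F, hn]
  have hFmono : Monotone (F μ) := fun s t hst =>
    measure_mono (Set.preimage_mono (Set.Iic_subset_Iic.2 hst))
  have hkey : ∀ (j : ℕ) (s : ℝ), T j μ ≤ s ↔ (j : ℝ≥0∞) + 1 ≤ F μ s := by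
    intro j s
    constructor
    · intro hT
      have hq : ∀ t : ℝ, s < t → (j : ℝ≥0∞) + 1 ≤ F μ t := by
        intro t hst
        have : T j μ < (t : EReal) := lt_of_le_of_lt hT (by exact_mod_cast hst)
        obtain ⟨q, hq⟩ := iInf_lt_iff.1 this
        split_ifs at hq with h1
        · exact h1.trans (hFmono (by exact_mod_cast hq.le))
        · exact absurd hq (by simp)
      have hlim : Filter.Tendsto (fun n : ℕ => F μ (s + 1 / ((n : ℝ) + 1))) Filter.atTop
          (nhds (F μ s)) := by
        have e : g ⁻¹' Set.Iic s = ⋂ n : ℕ, g ⁻¹' Set.Iic (s + 1 / ((n : ℝ) + 1)) := by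
          ext x
          simp only [Set.mem_preimage, Set.mem_Iic, Set.mem_iInter]
          constructor
          · intro hx n
            have : (0 : ℝ) < 1 / ((n : ℝ) + 1) := by positivity
            linarith
          · intro hx
            refine le_of_forall_pos_lt_add fun ε hε => ?_
            obtain ⟨n, hn⟩ := exists_nat_one_div_lt hε
            linarith [hx n]
        show Filter.Tendsto _ _ (nhds (μ _))
        rw [e]
        refine tendsto_measure_iInter_atTop
          (fun n => (hg.measurable measurableSet_Iic).nullMeasurableSet) ?_ ⟨0, hFfin _⟩
        intro a b hab
        refine Set.preimage_mono (Set.Iic_subset_Iic.2 ?_)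
        have := Nat.one_div_le_one_div (α := ℝ) hab
        linarith
      refine ge_of_tendsto' hlim fun n => hq _ ?_
      have : (0 : ℝ) < 1 / ((n : ℝ) + 1) := by positivity
      linarith
    · intro hF
      refine le_of_forall_gt fun b hb => ?_
      obtain ⟨q, hq1, hq2⟩ := EReal.lt_iff_exists_rat_btwn.1 hb
      refine lt_of_le_of_lt (iInf_le _ q) ?_
      have hsq : s ≤ q := by exact_mod_cast hq1.le
      rw [if_pos (hF.trans (hFmono hsq))]
      exact hq2
  have hFlim : Filter.Tendsto (fun n : ℕ => F μ n) Filter.atTop (nhds (μ Set.univ)) := by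
    have e : (Set.univ : Set (Space d)) = ⋃ n : ℕ, g ⁻¹' Set.Iic (n : ℝ) := by
      ext x
      simp [exists_nat_ge (g x)]
    rw [e]
    exact tendsto_measure_iUnion_atTop fun a b hab =>
      Set.preimage_mono (Set.Iic_subset_Iic.2 (by exact_mod_cast hab))
  have hTreal : ∀ j : ℕ, (j : ℝ≥0∞) + 1 ≤ μ Set.univ → ((T j μ).toReal : EReal) = T j μ := by
    intro j hj
    refine EReal.coe_toReal ?_ ?_
    · have hlt : (j : ℝ≥0∞) < μ Set.univ :=
        lt_of_lt_of_le (ENNReal.lt_add_right (by simp) one_ne_zero) hj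
      obtain ⟨n, hn⟩ := (hFlim.eventually (lt_mem_nhds hlt)).exists
      have h2 : (j : ℝ≥0∞) + 1 ≤ F μ n := by
        obtain ⟨k, hk⟩ := hμ _ (hg.measurable measurableSet_Iic) (hgb n)
        simp only [F] at hn ⊢
        rw [hk] at hn ⊢
        exact_mod_cast hn
      exact ne_top_of_le_ne_top (EReal.coe_ne_top _) ((hkey j n).2 h2)
    · intro hbot
      have h3 : (j : ℝ≥0∞) + 1 ≤ F μ (-1) := (hkey j (-1)).1 (by rw [hbot]; exact bot_le)
      have h4 : g ⁻¹' Set.Iic (-1 : ℝ) = ∅ := by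
        ext x
        simp only [Set.mem_preimage, Set.mem_Iic, Set.mem_empty_iff_false, iff_false]
        linarith [hg0 x]
      simp [F, h4] at h3
  have hmap : μ.map g = Measure.sum fun i : ℕ =>
      if (i : ℕ∞) < c (μ Set.univ) then Measure.dirac (T i μ).toReal else 0 := by
    have happ : ∀ s : ℝ, (Measure.sum fun i : ℕ =>
      if (i : ℕ∞) < c (μ Set.univ) then Measure.dirac (T i μ).toReal else 0) (Set.Iic s)
        = F μ s := by
      intro s
      rw [Measure.sum_apply _ measurableSet_Iic]
      obtain ⟨k, hk⟩ := hμ _ (hg.measurable measurableSet_Iic) (hgb s)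
      have hk' : F μ s = k := hk
      have hterm : ∀ i : ℕ, (if (i : ℕ∞) < c (μ Set.univ) then Measure.dirac (T i μ).toReal
          else 0 : Measure ℝ) (Set.Iic s) = if i ∈ Finset.range k then 1 else 0 := by
        intro i
        have hik : i ∈ Finset.range k ↔ (i : ℝ≥0∞) + 1 ≤ F μ s := by
          rw [hk', Finset.mem_range, Nat.lt_iff_add_one_le]
          exact_mod_cast Iff.rfl
        by_cases hi : (i : ℕ∞) < c (μ Set.univ)
        · rw [if_pos hi, Measure.dirac_apply' _ measurableSet_Iic, Set.indicator_apply]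
          have : (T i μ).toReal ∈ Set.Iic s ↔ i ∈ Finset.range k := by
            rw [hik, ← hkey, ← hTreal i ((hcard i).1 hi), Set.mem_Iic, EReal.toReal_coe,
              EReal.coe_le_coe_iff]
          simp only [this, Pi.one_apply]
        · have : ¬ i ∈ Finset.range k := fun h => hi ((hcard i).2
            ((hik.1 h).trans (measure_mono (Set.subset_univ _))))
          rw [if_neg hi, if_neg this]
          rfl
      simp_rw [hterm]
      rw [hk', tsum_eq_sum (s := Finset.range k) (by intro b hb; exact if_neg hb),
        Finset.sum_congr rfl (fun i hi => if_pos hi)]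
      simp
    refine Measure.ext_of_generateFrom_of_iUnion (Set.range Set.Iic) (fun n : ℕ => Set.Iic (n : ℝ))
      (borel_eq_generateFrom_Iic ℝ ▸ (BorelSpace.measurable_eq (α := ℝ))) isPiSystem_Iic ?_
      (fun n => ⟨_, rfl⟩) ?_ ?_
    · ext x
      simp [exists_nat_ge x]
    · intro n
      rw [hg.map_apply]
      exact hFfin n
    · rintro _ ⟨s, rfl⟩
      rw [happ, hg.map_apply]
  have hback : μ = (μ.map g).map h := by
    rw [Measure.map_map hh hg.measurable]
    have : h ∘ g = id := funext hhg
    rw [this, Measure.map_id]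
  conv_lhs => rw [hback, hmap]
  rw [pointSum, Measure.map_sum hh.aemeasurable]
  congr 1
  funext i
  split_ifs
  · rw [Measure.map_dirac' hh]
  · simp

section CountingMeasures

variable {d : ℕ}

/-- A sum of Dirac measures over the indices satisfying `c` counts these indices. -/
theorem sum_ite_dirac_apply (c : ℕ → Prop) [DecidablePred c] (x : ℕ → Space d)
    {B : Set (Space d)} (hB : MeasurableSet B) :
    Measure.sum (fun i => if c i then Measure.dirac (x i) else 0) B
      = ({i | c i ∧ x i ∈ B}.encard : ℝ≥0∞) := by
  rw [Measure.sum_apply _ hB, ← ENNReal.tsum_set_one,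
    tsum_subtype {i | c i ∧ x i ∈ B} (fun _ => (1 : ℝ≥0∞))]
  refine tsum_congr fun i => ?_
  by_cases hc : c i <;> by_cases hx : x i ∈ B <;> simp [hc, hx, hB]

theorem pointSum_apply (k : ℕ∞) (x : ℕ → Space d) {B : Set (Space d)} (hB : MeasurableSet B) :
    pointSum k x B = ({i : ℕ | (i : ℕ∞) < k ∧ x i ∈ B}.encard : ℝ≥0∞) :=
  sum_ite_dirac_apply _ x hB

theorem thinning_apply (k : ℕ∞) (x : ℕ → Space d) (u : ℕ → ℝ) (q : Space d → ℝ)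
    {B : Set (Space d)} (hB : MeasurableSet B) :
    thinning k x u q B
      = ({i : ℕ | ((i : ℕ∞) < k ∧ u i ≤ q (x i)) ∧ x i ∈ B}.encard : ℝ≥0∞) :=
  sum_ite_dirac_apply _ x hB

/-- A locally finite configuration has finitely many points in a bounded set. -/
theorem IsConfiguration.finite_index {k : ℕ∞} {x : ℕ → Space d}
    (h : IsConfiguration (pointSum k x)) {B : Set (Space d)} (hB : MeasurableSet B)
    (hb : Bornology.IsBounded B) : {i : ℕ | (i : ℕ∞) < k ∧ x i ∈ B}.Finite := by
  obtain ⟨n, hn⟩ := h B hB hb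
  rw [pointSum_apply k x hB] at hn
  rw [← Set.encard_ne_top_iff]
  intro htop
  simp [htop] at hn

theorem IsConfiguration.thinning {k : ℕ∞} {x : ℕ → Space d}
    (h : IsConfiguration (pointSum k x)) (u : ℕ → ℝ) (q : Space d → ℝ) :
    IsConfiguration (thinning k x u q) := by
  intro B hB hb
  have hfin : {i : ℕ | ((i : ℕ∞) < k ∧ u i ≤ q (x i)) ∧ x i ∈ B}.Finite :=
    (h.finite_index hB hb).subset fun i hi => ⟨hi.1.1, hi.2⟩
  refine ⟨{i : ℕ | ((i : ℕ∞) < k ∧ u i ≤ q (x i)) ∧ x i ∈ B}.ncard, ?_⟩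
  rw [thinning_apply k x u q hB, ← hfin.cast_ncard_eq]
  simp

/-- A random sum of Dirac measures at random points is a random measure. -/
theorem measurable_sum_ite_dirac {Ω : Type*} [MeasurableSpace Ω] {c : ℕ → Ω → Prop}
    [∀ i ω, Decidable (c i ω)] {ξ : ℕ → Ω → Space d}
    (hc : ∀ i, MeasurableSet {ω | c i ω}) (hξ : ∀ i, Measurable (ξ i)) :
    Measurable fun ω => Measure.sum fun i => if c i ω then Measure.dirac (ξ i ω) else 0 := by
  refine Measure.measurable_of_measurable_coe _ fun B hB => ?_
  simp_rw [Measure.sum_apply _ hB]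
  refine Measurable.tsum fun i => ?_
  have : (fun ω => (if c i ω then Measure.dirac (ξ i ω) else 0 : Measure (Space d)) B)
      = {ω | c i ω}.indicator ((ξ i ⁻¹' B).indicator 1) := by
    funext ω
    by_cases h : c i ω <;> by_cases hx : ξ i ω ∈ B <;> simp [h, hx, hB, Set.indicator]
  rw [this]
  exact (measurable_one.indicator (hξ i hB)).indicator (hc i)

/-- The number of neighbours of the `i`-th point depends measurably on the list of points. -/
theorem measurable_neighbourCount_pointSum (r : ℝ) (i : ℕ) :
    Measurable fun z : ℕ∞ × (ℕ → Space d) => neighbourCount r (z.2 i) (pointSum z.1 z.2) := by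
  have hx : ∀ j, Measurable fun z : ℕ∞ × (ℕ → Space d) => z.2 j := fun j => by fun_prop
  refine Nat.measurable_floor.comp (ENNReal.measurable_toReal.comp ?_)
  have : (fun z : ℕ∞ × (ℕ → Space d) => pointSum z.1 z.2 (closedBall (z.2 i) r \ {z.2 i}))
      = fun z => ∑' j : ℕ, {z : ℕ∞ × (ℕ → Space d) | (j : ℕ∞) < z.1 ∧
          (dist (z.2 j) (z.2 i) ≤ r ∧ z.2 j ≠ z.2 i)}.indicator 1 z := by
    funext z
    have hB : MeasurableSet (closedBall (z.2 i) r \ {z.2 i}) :=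
      measurableSet_closedBall.diff (measurableSet_singleton _)
    rw [pointSum_apply _ _ hB, ← ENNReal.tsum_set_one,
      tsum_subtype _ (fun _ => (1 : ℝ≥0∞))]
    exact tsum_congr fun j => by simp [Set.indicator]
  rw [this]
  refine Measurable.tsum fun j => measurable_one.indicator ?_
  refine (measurable_fst (MeasurableSet.of_discrete (s := Set.Ioi (j : ℕ∞)))).inter
    (MeasurableSet.inter ?_ (MeasurableSet.compl ?_))
  · exact measurableSet_le ((hx j).dist (hx i)) measurable_const
  · exact measurableSet_eq_fun (hx j) (hx i)

/-- Two thinnings that agree on the points in `W` have the same restriction to `W`. -/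
theorem restrict_thinning_congr {k : ℕ∞} {x : ℕ → Space d} {u : ℕ → ℝ} {q q' : Space d → ℝ}
    {W : Set (Space d)} (hW : MeasurableSet W)
    (h : ∀ i : ℕ, (i : ℕ∞) < k → x i ∈ W → (u i ≤ q (x i) ↔ u i ≤ q' (x i))) :
    (thinning k x u q).restrict W = (thinning k x u q').restrict W := by
  ext B hB
  rw [Measure.restrict_apply hB, Measure.restrict_apply hB, thinning_apply _ _ _ _ (hB.inter hW),
    thinning_apply _ _ _ _ (hB.inter hW)]
  congr 2
  ext i
  simp only [Set.mem_ofPred_eq, Set.mem_inter_iff]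
  constructor
  · rintro ⟨⟨h1, h2⟩, h3, h4⟩
    exact ⟨⟨h1, (h i h1 h4).1 h2⟩, h3, h4⟩
  · rintro ⟨⟨h1, h2⟩, h3, h4⟩
    exact ⟨⟨h1, (h i h1 h4).2 h2⟩, h3, h4⟩

end CountingMeasures

section Independence

variable {Ω α β : Type*} [MeasurableSpace Ω] [MeasurableSpace α] [MeasurableSpace β]
  {P : Measure Ω} [IsProbabilityMeasure P] {V : Ω → α} {Z : Ω → β}

/-- A function of two independent variables is integrated by first freezing the second one. -/
theorem lintegral_eq_lintegral_lintegral_of_indepFun (h : IndepFun V Z P) (hV : Measurable V)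
    (hZ : Measurable Z) {F : α × β → ℝ≥0∞} (hF : Measurable F) :
    ∫⁻ ω, F (V ω, Z ω) ∂P = ∫⁻ ω, ∫⁻ ω', F (V ω', Z ω) ∂P ∂P := by
  have := Measure.isProbabilityMeasure_map (μ := P) hV.aemeasurable
  have := Measure.isProbabilityMeasure_map (μ := P) hZ.aemeasurable
  rw [← lintegral_map (f := F) hF (hV.prodMk hZ),
    (indepFun_iff_map_prod_eq_prod_map_map hV.aemeasurable hZ.aemeasurable).1 h,
    lintegral_prod_symm' _ hF, lintegral_map hF.lintegral_prod_left' hZ]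
  refine lintegral_congr fun ω => ?_
  exact lintegral_map (hF.comp measurable_prodMk_right) hV

/-- A bounded function of two independent variables is integrated by first freezing the second
one. -/
theorem integral_eq_integral_integral_of_indepFun (h : IndepFun V Z P) (hV : Measurable V)
    (hZ : Measurable Z) {F : α × β → ℂ} (hF : Measurable F) {C : ℝ} (hC : ∀ z, ‖F z‖ ≤ C) :
    ∫ ω, F (V ω, Z ω) ∂P = ∫ ω, ∫ ω', F (V ω', Z ω) ∂P ∂P := by
  have := Measure.isProbabilityMeasure_map (μ := P) hV.aemeasurable
  have := Measure.isProbabilityMeasure_map (μ := P) hZ.aemeasurable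
  rw [← integral_map (f := F) (hV.prodMk hZ).aemeasurable hF.aestronglyMeasurable,
    (indepFun_iff_map_prod_eq_prod_map_map hV.aemeasurable hZ.aemeasurable).1 h,
    integral_prod_symm _ (Integrable.of_bound hF.aestronglyMeasurable C (.of_forall hC)),
    integral_map hZ.aemeasurable
      (hF.stronglyMeasurable.integral_prod_left').aestronglyMeasurable]
  refine integral_congr_ae (.of_forall fun ω => ?_)
  exact integral_map hV.aemeasurable (hF.comp measurable_prodMk_right).aestronglyMeasurable

end Independence

section Marking

variable {d : ℕ} {Ω : Type*} [MeasurableSpace Ω] {P : Measure Ω}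
  {X : Ω → Measure (Space d)} {κ : Ω → ℕ∞} {ξ : ℕ → Ω → Space d} {U : ℕ → Ω → ℝ}

theorem IsUniformMarking.measurable_list (hU : IsUniformMarking X κ ξ U P) :
    Measurable fun ω => (κ ω, fun i => ξ i ω) :=
  hU.measurable_card.prodMk (measurable_pi_lambda _ hU.measurable_point)

theorem IsUniformMarking.isConfiguration (hU : IsUniformMarking X κ ξ U P) (hX : IsPointProcess X)
    (ω : Ω) : IsConfiguration (pointSum (κ ω) (fun i => ξ i ω)) :=
  hU.eq_pointSum ω ▸ hX.isConfiguration ω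

theorem IsUniformMarking.measurable_neighbourCount (hU : IsUniformMarking X κ ξ U P) (r : ℝ)
    (i : ℕ) : Measurable fun ω => neighbourCount r (ξ i ω) (X ω) := by
  have h := (measurable_neighbourCount_pointSum (d := d) r i).comp hU.measurable_list
  have e : (fun ω => neighbourCount r (ξ i ω) (X ω)) = (fun z : ℕ∞ × (ℕ → Space d) =>
      neighbourCount r (z.2 i) (pointSum z.1 z.2)) ∘ fun ω => (κ ω, fun i => ξ i ω) := by
    funext ω
    rw [hU.eq_pointSum ω, Function.comp_apply]
  rw [e]
  exact h

theorem IsUniformMarking.isPointProcess_neighbourThinning (hU : IsUniformMarking X κ ξ U P)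
    (hX : IsPointProcess X) (r : ℝ) (p : ℕ → ℝ) :
    IsPointProcess (neighbourThinning r p X κ ξ U) where
  measurable := by
    refine measurable_sum_ite_dirac (fun i => ?_) hU.measurable_point
    exact (hU.measurable_card (MeasurableSet.of_discrete (s := Set.Ioi (i : ℕ∞)))).inter
      (measurableSet_le (hU.measurable_mark i)
        ((measurable_from_nat (f := p)).comp (hU.measurable_neighbourCount r i)))
  isConfiguration ω := (hU.isConfiguration hX ω).thinning _ _

theorem IsUniformMarking.isPointProcess_independentThinning (hU : IsUniformMarking X κ ξ U P)
    (hX : IsPointProcess X) (m : ℝ) : IsPointProcess (independentThinning m κ ξ U) where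
  measurable := by
    refine measurable_sum_ite_dirac (fun i => ?_) hU.measurable_point
    exact (hU.measurable_card (MeasurableSet.of_discrete (s := Set.Ioi (i : ℕ∞)))).inter
      (measurableSet_le (hU.measurable_mark i) measurable_const)
  isConfiguration ω := (hU.isConfiguration hX ω).thinning _ _

end Marking

section Counts

variable {d : ℕ} {Ω : Type*} [MeasurableSpace Ω] {P : Measure Ω}

/-- The number of points of the configuration `μ` in `B`, as a natural number. -/
noncomputable def natCount (B : Set (Space d)) (μ : Measure (Space d)) : ℕ := ⌊(μ B).toReal⌋₊

theorem measurable_natCount {B : Set (Space d)} (hB : MeasurableSet B) :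
    Measurable (natCount B) :=
  Nat.measurable_floor.comp (ENNReal.measurable_toReal.comp (Measure.measurable_coe hB))

theorem natCount_eq_of_apply_eq {B : Set (Space d)} {μ : Measure (Space d)} {n : ℕ}
    (h : μ B = n) : natCount B μ = n := by
  simp [natCount, h]

theorem IsConfiguration.coe_natCount {μ : Measure (Space d)} (h : IsConfiguration μ)
    {B : Set (Space d)} (hB : MeasurableSet B) (hb : Bornology.IsBounded B) :
    (natCount B μ : ℝ≥0∞) = μ B := by
  obtain ⟨n, hn⟩ := h B hB hb
  rw [natCount_eq_of_apply_eq hn, hn]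

theorem natCount_neighbours (r : ℝ) (x : Space d) (μ : Measure (Space d)) :
    neighbourCount r x μ = natCount (closedBall x r \ {x}) μ := rfl

variable {X : Ω → Measure (Space d)} {Λ : Measure (Space d)} [IsLocallyFiniteMeasure Λ]

theorem IsPoissonProcess.hasLaw_natCount (hX : IsPoissonProcess X Λ P) {B : Set (Space d)}
    (hB : MeasurableSet B) (hb : Bornology.IsBounded B) :
    HasLaw (fun ω => natCount B (X ω)) (poissonMeasure (Λ B).toNNReal) P where
  aemeasurable := ((measurable_natCount hB).comp hX.measurable).aemeasurable
  map_eq := by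
    have hf : Measurable fun a : ℝ≥0∞ => ⌊a.toReal⌋₊ :=
      Nat.measurable_floor.comp ENNReal.measurable_toReal
    have h := (hX.hasLaw B hB hb).map_eq
    have e : (fun ω => natCount B (X ω)) = (fun a : ℝ≥0∞ => ⌊a.toReal⌋₊) ∘ fun ω => X ω B := rfl
    rw [e, ← Measure.map_map hf (show Measurable fun ω => X ω B from
        (Measure.measurable_coe hB).comp hX.measurable), h,
      Measure.map_map hf .of_discrete]
    convert Measure.map_id
    funext n
    simp

theorem IsPoissonProcess.iIndepFun_natCount (hX : IsPoissonProcess X Λ P) {k : ℕ}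
    {A : Fin k → Set (Space d)} (hA : ∀ i, MeasurableSet (A i))
    (hb : ∀ i, Bornology.IsBounded (A i)) (hd : Pairwise fun i j => Disjoint (A i) (A j)) :
    iIndepFun (fun i ω => natCount (A i) (X ω)) P :=
  (hX.indep k A hA hb hd).comp (fun _ a => ⌊a.toReal⌋₊)
    fun _ => Nat.measurable_floor.comp ENNReal.measurable_toReal

theorem toNNReal_smul_apply (a : ℝ≥0) (ν : Measure (Space d)) (B : Set (Space d)) :
    ((a • ν) B).toNNReal = a * (ν B).toNNReal := by
  rw [Measure.smul_apply, ENNReal.smul_def, smul_eq_mul, ENNReal.toNNReal_mul,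
    ENNReal.toNNReal_coe]

/-- The probability generating function of the Poisson distribution. -/
theorem integral_pow_poissonMeasure (a : ℝ≥0) (w : ℂ) :
    ∫ n, w ^ n ∂(poissonMeasure a) = Complex.exp (a * (w - 1)) := by
  rw [integral_poissonMeasure]
  have h := (NormedSpace.expSeries_div_hasSum_exp ((a : ℂ) * w)).mul_left (Complex.exp (-a))
  rw [← Complex.exp_eq_exp_ℂ, ← Complex.exp_add] at h
  rw [show (a : ℂ) * (w - 1) = -a + a * w by ring, ← h.tsum_eq]
  refine tsum_congr fun n => ?_
  rw [Complex.real_smul]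
  push_cast
  rw [mul_pow]
  ring

theorem IsPoissonProcess.integral_prod_pow_natCount (hX : IsPoissonProcess X Λ P) {k : ℕ}
    {A : Fin k → Set (Space d)} (hA : ∀ i, MeasurableSet (A i))
    (hb : ∀ i, Bornology.IsBounded (A i)) (hd : Pairwise fun i j => Disjoint (A i) (A j))
    (w : Fin k → ℂ) :
    ∫ ω, ∏ j, w j ^ natCount (A j) (X ω) ∂P
      = ∏ j, Complex.exp ((Λ (A j)).toNNReal * (w j - 1)) := by
  have hm : ∀ j, AEMeasurable (fun ω => natCount (A j) (X ω)) P := fun j =>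
    ((measurable_natCount (hA j)).comp hX.measurable).aemeasurable
  rw [(hX.iIndepFun_natCount hA hb hd).integral_fun_prod_comp (f := fun j n => w j ^ n) hm
    fun _ => .of_discrete]
  refine Finset.prod_congr rfl fun j _ => ?_
  rw [← integral_pow_poissonMeasure, ← (hX.hasLaw_natCount (hA j) (hb j)).map_eq,
    integral_map (hm j) .of_discrete]

open Complex in
/-- A point process is Poisson if its counts have the joint generating function of independent
Poisson variables on the unit torus. -/
theorem IsPointProcess.isPoissonProcess_of_integral_prod_pow [IsProbabilityMeasure P]
    (hX : IsPointProcess X)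
    (h : ∀ (k : ℕ) (A : Fin k → Set (Space d)), (∀ i, MeasurableSet (A i)) →
      (∀ i, Bornology.IsBounded (A i)) → Pairwise (fun i j => Disjoint (A i) (A j)) →
      ∀ t : Fin k → ℝ, ∫ ω, ∏ j, cexp (t j * I) ^ natCount (A j) (X ω) ∂P
        = ∏ j, cexp ((Λ (A j)).toNNReal * (cexp (t j * I) - 1))) :
    IsPoissonProcess X Λ P := by
  have hmeas : ∀ B : Set (Space d), MeasurableSet B →
      Measurable fun ω => ((natCount B (X ω) : ℕ) : ℝ) := fun B hB =>
    (measurable_from_nat (f := fun n : ℕ => (n : ℝ))).comp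
      ((measurable_natCount hB).comp hX.measurable)
  have hchar : ∀ B : Set (Space d), MeasurableSet B → Bornology.IsBounded B → ∀ t : ℝ,
      charFun (P.map fun ω => ((natCount B (X ω) : ℕ) : ℝ)) t
        = cexp ((Λ B).toNNReal * (cexp (t * I) - 1)) := by
    intro B hB hb t
    have := h 1 (fun _ => B) (fun _ => hB) (fun _ => hb)
      (fun i j hij => absurd (Subsingleton.elim i j) hij) (fun _ => t)
    simp only [Finset.univ_unique, Finset.prod_singleton] at this
    rw [← this, charFun_apply_real, integral_map (hmeas B hB).aemeasurable (by fun_prop)]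
    refine integral_congr_ae (.of_forall fun ω => ?_)
    simp only
    rw [← Complex.exp_nat_mul]
    congr 1
    push_cast
    ring
  have hcoe : ∀ B : Set (Space d), MeasurableSet B → Bornology.IsBounded B → ∀ ω,
      X ω B = ENNReal.ofReal ((natCount B (X ω) : ℕ) : ℝ) := fun B hB hb ω => by
    rw [ENNReal.ofReal_natCast, (hX.isConfiguration ω).coe_natCount hB hb]
  refine ⟨hX, fun B hB hb => ⟨((Measure.measurable_coe hB).comp hX.measurable).aemeasurable, ?_⟩,
    fun k A hA hb hd => ?_⟩
  · have hlaw : P.map (fun ω => ((natCount B (X ω) : ℕ) : ℝ))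
        = (poissonMeasure (Λ B).toNNReal).map (fun n : ℕ => (n : ℝ)) := by
      have := Measure.isProbabilityMeasure_map (μ := P) (hmeas B hB).aemeasurable
      apply Measure.ext_of_charFun
      funext t
      rw [hchar B hB hb t, charFun_map_cast_poissonMeasure]
    have e : (fun ω => X ω B) = ENNReal.ofReal ∘ fun ω => ((natCount B (X ω) : ℕ) : ℝ) :=
      funext (hcoe B hB hb)
    rw [e, ← Measure.map_map ENNReal.measurable_ofReal (hmeas B hB), hlaw,
      Measure.map_map ENNReal.measurable_ofReal .of_discrete]
    congr 1
    funext n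
    simp
  · have hind : iIndepFun (fun j ω => ((natCount (A j) (X ω) : ℕ) : ℝ)) P := by
      rw [iIndepFun_iff_charFun_pi fun j => (hmeas _ (hA j)).aemeasurable]
      intro t
      simp_rw [hchar _ (hA _) (hb _)]
      rw [← h k A hA hb hd (fun j => t j), charFun_apply,
        integral_map (by
          refine (WithLp.measurable_toLp 2 _).comp_aemeasurable ?_
          exact (measurable_pi_lambda _ fun j => hmeas _ (hA j)).aemeasurable) (by fun_prop)]
      refine integral_congr_ae (.of_forall fun ω => ?_)
      simp only [PiLp.inner_apply]
      rw [Complex.ofReal_sum, Finset.sum_mul, Complex.exp_sum]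
      refine Finset.prod_congr rfl fun j _ => ?_
      rw [← Complex.exp_nat_mul]
      congr 1
      simp [mul_assoc]
      ring
    have e : (fun j ω => X ω (A j))
        = fun j => ENNReal.ofReal ∘ fun ω => ((natCount (A j) (X ω) : ℕ) : ℝ) := by
      funext j ω
      exact hcoe _ (hA j) (hb j) ω
    rw [e]
    exact hind.comp (fun _ => ENNReal.ofReal) fun _ => ENNReal.measurable_ofReal

end Counts

section IndependentThinning

variable {d : ℕ} {Ω : Type*} [MeasurableSpace Ω] {P : Measure Ω}
  {X : Ω → Measure (Space d)} {κ : Ω → ℕ∞} {ξ : ℕ → Ω → Space d} {U : ℕ → Ω → ℝ}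

theorem IsUniformMarking.measure_mark_mem_Ioc (hU : IsUniformMarking X κ ξ U P) (i : ℕ) {a b : ℝ}
    (ha : 0 ≤ a) (hb : b ≤ 1) : P {ω | U i ω ∈ Set.Ioc a b} = ENNReal.ofReal (b - a) := by
  have h : P {ω | U i ω ∈ Set.Ioc a b} = P.map (U i) (Set.Ioc a b) :=
    (Measure.map_apply (hU.measurable_mark i) measurableSet_Ioc).symm
  rw [h, (hU.hasLaw_mark i).map_eq, restrict_Ioo_eq_restrict_Ioc,
    Measure.restrict_apply measurableSet_Ioc, Set.inter_eq_left.2 (Set.Ioc_subset_Ioc ha hb),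
    Real.volume_Ioc]

theorem IsUniformMarking.measureReal_mark_le (hU : IsUniformMarking X κ ξ U P) (i : ℕ) {m : ℝ}
    (hm : m ∈ Set.Icc (0 : ℝ) 1) : P.real {ω | U i ω ≤ m} = m := by
  have h : P {ω | U i ω ≤ m} = P.map (U i) (Set.Iic m) :=
    (Measure.map_apply (hU.measurable_mark i) measurableSet_Iic).symm
  rw [measureReal_def, h, (hU.hasLaw_mark i).map_eq, restrict_Ioo_eq_restrict_Ioc,
    Measure.restrict_apply measurableSet_Iic, Set.inter_comm, Set.Ioc_inter_Iic,
    inf_eq_right.2 hm.2, Real.volume_Ioc, sub_zero, ENNReal.toReal_ofReal hm.1]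

theorem IsUniformMarking.integral_ite_mark_le [IsProbabilityMeasure P]
    (hU : IsUniformMarking X κ ξ U P) (i : ℕ) {m : ℝ} (hm : m ∈ Set.Icc (0 : ℝ) 1) (a : ℂ) :
    ∫ ω, (if U i ω ≤ m then a else 1) ∂P = 1 + m * (a - 1) := by
  have hs : MeasurableSet {ω | U i ω ≤ m} :=
    measurableSet_le (hU.measurable_mark i) measurable_const
  have e : (fun ω => if U i ω ≤ m then a else 1)
      = fun ω => 1 + {ω | U i ω ≤ m}.indicator (fun _ => a - 1) ω := by
    funext ω
    by_cases h : U i ω ≤ m <;> simp [h]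
  rw [e, integral_add (integrable_const _) ((integrable_const _).indicator hs),
    integral_indicator_const _ hs, hU.measureReal_mark_le i hm]
  simp

/-- The generating function of the counts of a fixed finite list of points, thinned
independently. -/
theorem IsUniformMarking.integral_prod_pow_natCount_thinning [IsProbabilityMeasure P]
    (hU : IsUniformMarking X κ ξ U P) {m : ℝ} (hm : m ∈ Set.Icc (0 : ℝ) 1)
    {n : ℕ∞} {x : ℕ → Space d} (hx : IsConfiguration (pointSum n x)) {k : ℕ}
    {A : Fin k → Set (Space d)} (hA : ∀ i, MeasurableSet (A i))
    (hb : ∀ i, Bornology.IsBounded (A i)) (hd : Pairwise fun i j => Disjoint (A i) (A j))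
    (c : Fin k → ℂ) :
    ∫ ω, ∏ j, c j ^ natCount (A j) (thinning n x (fun i => U i ω) fun _ => m) ∂P
      = ∏ j, (1 + m * (c j - 1)) ^ natCount (A j) (pointSum n x) := by
  classical
  have hfin : {i : ℕ | (i : ℕ∞) < n ∧ x i ∈ ⋃ j, A j}.Finite :=
    hx.finite_index (.iUnion hA) ((Bornology.isBounded_iUnion).2 hb)
  let F : Finset ℕ := hfin.toFinset
  have hF : ∀ i, i ∈ F ↔ (i : ℕ∞) < n ∧ ∃ j, x i ∈ A j := fun i => by simp [F]
  have hthin : ∀ (j : Fin k) (u : ℕ → ℝ), natCount (A j) (thinning n x u fun _ => m)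
      = (F.filter fun i => u i ≤ m ∧ x i ∈ A j).card := fun j u => by
    refine natCount_eq_of_apply_eq ?_
    rw [thinning_apply _ _ _ _ (hA j)]
    have : {i : ℕ | ((i : ℕ∞) < n ∧ u i ≤ m) ∧ x i ∈ A j}
        = ((F.filter fun i => u i ≤ m ∧ x i ∈ A j : Finset ℕ) : Set ℕ) := by
      ext i
      simp only [Set.mem_ofPred_eq, Finset.coe_filter, hF]
      exact ⟨fun h => ⟨⟨h.1.1, j, h.2⟩, h.1.2, h.2⟩, fun h => ⟨⟨h.1.1, h.2.1⟩, h.2.2⟩⟩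
    rw [this, Set.encard_coe_eq_coe_finsetCard]
    simp
  have hsum : ∀ j, natCount (A j) (pointSum n x) = (F.filter fun i => x i ∈ A j).card := fun j => by
    refine natCount_eq_of_apply_eq ?_
    rw [pointSum_apply _ _ (hA j)]
    have : {i : ℕ | (i : ℕ∞) < n ∧ x i ∈ A j}
        = ((F.filter fun i => x i ∈ A j : Finset ℕ) : Set ℕ) := by
      ext i
      simp only [Set.mem_ofPred_eq, Finset.coe_filter, hF]
      exact ⟨fun h => ⟨⟨h.1, j, h.2⟩, h.2⟩, fun h => ⟨h.1.1, h.2⟩⟩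
    rw [this, Set.encard_coe_eq_coe_finsetCard]
    simp
  have hpow : ∀ (a : ℂ) (q : ℕ → Prop) [DecidablePred q],
      a ^ (F.filter q).card = ∏ i : F, if q i then a else 1 := fun a q _ => by
    rw [Finset.prod_coe_sort F (fun i => if q i then a else 1), Finset.prod_ite]
    simp
  simp_rw [hthin, hsum, hpow]
  simp_rw [Finset.prod_comm (s := (Finset.univ : Finset (Fin k)))]
  have hprod : ∀ (i : F) (u : ℝ), (∏ j, if u ≤ m ∧ x i ∈ A j then c j else 1)
      = if u ≤ m then (∏ j, if x i ∈ A j then c j else 1) else 1 := fun i u => by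
    by_cases h : u ≤ m <;> simp [h]
  simp_rw [hprod]
  have hind : iIndepFun (fun (i : F) => U i) P :=
    hU.iIndepFun_mark.precomp Subtype.val_injective
  rw [hind.integral_fun_prod_comp
    (f := fun (i : F) u => if u ≤ m then (∏ j, if x i ∈ A j then c j else 1) else 1)
    (fun i => (hU.measurable_mark i).aemeasurable)
    fun i => (Measurable.ite measurableSet_Iic measurable_const
      measurable_const).aestronglyMeasurable]
  refine Finset.prod_congr rfl fun i _ => ?_
  rw [hU.integral_ite_mark_le i hm]
  obtain ⟨j, hj⟩ := ((hF i).1 i.2).2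
  have hne : ∀ l, l ≠ j → x i ∉ A l := fun l hl h => Set.disjoint_left.1 (hd hl) h hj
  rw [Finset.prod_eq_single j (fun l _ hl => if_neg (hne l hl)) (by simp),
    Finset.prod_eq_single j (fun l _ hl => if_neg (hne l hl)) (by simp), if_pos hj, if_pos hj]

theorem measurable_thinning_const (m : ℝ) :
    Measurable fun z : (ℕ → ℝ) × (ℕ∞ × (ℕ → Space d)) =>
      thinning z.2.1 z.2.2 z.1 fun _ => m := by
  have hx : ∀ i, Measurable fun z : (ℕ → ℝ) × (ℕ∞ × (ℕ → Space d)) => z.2.2 i := fun i => by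
    fun_prop
  have hu : ∀ i, Measurable fun z : (ℕ → ℝ) × (ℕ∞ × (ℕ → Space d)) => z.1 i := fun i => by
    fun_prop
  have hk : Measurable fun z : (ℕ → ℝ) × (ℕ∞ × (ℕ → Space d)) => z.2.1 := by fun_prop
  refine measurable_sum_ite_dirac (fun i => ?_) hx
  exact (hk (MeasurableSet.of_discrete (s := Set.Ioi (i : ℕ∞)))).inter
    (measurableSet_le (hu i) measurable_const)

open Complex in
/-- Independent thinning of a Poisson process yields a Poisson process. -/
theorem IsUniformMarking.isPoissonProcess_independentThinning [IsProbabilityMeasure P] {lam : ℝ≥0}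
    (hU : IsUniformMarking X κ ξ U P) (hX : IsPoissonProcess X (lam • volume) P) {m : ℝ}
    (hm : m ∈ Set.Icc (0 : ℝ) 1) :
    IsPoissonProcess (independentThinning m κ ξ U) ((lam * m.toNNReal) • volume) P := by
  refine (hU.isPointProcess_independentThinning hX.toIsPointProcess
    m).isPoissonProcess_of_integral_prod_pow fun k A hA hb hd t => ?_
  have hfub := integral_eq_integral_integral_of_indepFun hU.indepFun
    (measurable_pi_lambda _ hU.measurable_mark) hU.measurable_list (C := 1)
    (F := fun z : (ℕ → ℝ) × (ℕ∞ × (ℕ → Space d)) =>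
      ∏ j, cexp (t j * I) ^ natCount (A j) (thinning z.2.1 z.2.2 z.1 fun _ => m)) ?_ ?_
  · refine hfub.trans ?_
    have hinner : ∀ ω, ∫ ω', ∏ j, cexp (t j * I) ^ natCount (A j)
        (thinning (κ ω) (fun i => ξ i ω) (fun i => U i ω') fun _ => m) ∂P
        = ∏ j, (1 + m * (cexp (t j * I) - 1)) ^ natCount (A j) (X ω) := fun ω => by
      rw [hU.integral_prod_pow_natCount_thinning hm
        (hU.isConfiguration hX.toIsPointProcess ω) hA hb hd, hU.eq_pointSum ω]
    simp_rw [hinner]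
    rw [hX.integral_prod_pow_natCount hA hb hd]
    refine Finset.prod_congr rfl fun j _ => ?_
    congr 1
    rw [toNNReal_smul_apply, toNNReal_smul_apply]
    push_cast
    rw [Real.coe_toNNReal m hm.1]
    ring
  · refine Finset.measurable_prod _ fun j _ => ?_
    refine (measurable_from_nat (f := fun n : ℕ => cexp (t j * I) ^ n)).comp
      ((measurable_natCount (hA j)).comp ?_)
    exact measurable_thinning_const m
  · intro z
    simp [Complex.norm_exp_ofReal_mul_I]

end IndependentThinning

/-- The factorial moments of the Poisson distribution. -/
theorem lintegral_descFactorial_poissonMeasure (a : ℝ≥0) (j : ℕ) :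
    ∫⁻ n, (n.descFactorial j : ℝ≥0∞) ∂(poissonMeasure a) = (a : ℝ≥0∞) ^ j := by
  rw [poissonMeasure, lintegral_sum_measure]
  simp_rw [lintegral_smul_measure, lintegral_dirac, smul_eq_mul]
  rw [← Summable.sum_add_tsum_nat_add' (k := j) ENNReal.summable, Finset.sum_eq_zero, zero_add]
  · have hterm : ∀ n : ℕ, ENNReal.ofReal (Real.exp (-a) * a ^ (n + j) / (n + j).factorial)
        * ((n + j).descFactorial j : ℝ≥0∞)
        = (a : ℝ≥0∞) ^ j * ENNReal.ofReal (Real.exp (-a) * a ^ n / n.factorial) := by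
      intro n
      have hfac : (n.factorial : ℝ) * ((n + j).descFactorial j : ℝ) = (n + j).factorial := by
        have := Nat.factorial_mul_descFactorial (Nat.le_add_left j n)
        rw [Nat.add_sub_cancel] at this
        exact_mod_cast this
      rw [← ENNReal.ofReal_natCast, ← ENNReal.ofReal_mul (by positivity),
        ← ENNReal.ofReal_coe_nnreal, ← ENNReal.ofReal_pow (by positivity),
        ← ENNReal.ofReal_mul (by positivity)]
      congr 1
      have h0 : (n.factorial : ℝ) ≠ 0 := by positivity
      have h1 : ((n + j).factorial : ℝ) ≠ 0 := by positivity
      rw [← hfac] at h1 ⊢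
      have h2 := right_ne_zero_of_mul h1
      field_simp
      ring
    simp_rw [hterm]
    rw [ENNReal.tsum_mul_left, ← ENNReal.ofReal_tsum_of_nonneg (fun n => by positivity)
      (hasSum_one_poissonMeasure a).summable, (hasSum_one_poissonMeasure a).tsum_eq]
    simp
  · intro n hn
    rw [Nat.descFactorial_of_lt (Finset.mem_range.1 hn)]
    simp

section Cells

variable {d : ℕ}

/-- The points of a cell `Q` near `c` all have as many neighbours as there are points in the ball
around `c` outside of `Q`, unless there are two points in `Q` or a point in the shell `S`. -/
theorem neighbourCount_eq_of_mem_cell {μ : Measure (Space d)} {r ε : ℝ} {c x : Space d}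
    {Q : Set (Space d)} (hQc : Q ⊆ closedBall c ε) (hx : x ∈ Q)
    (hxμ : 1 ≤ μ {x}) (hQ : μ Q ≤ 1)
    (hS : μ ((closedBall c (r + ε) \ closedBall c (r - ε)) \ Q) = 0) :
    neighbourCount r x μ = natCount (closedBall c r \ Q) μ := by
  have hQx : μ (Q \ {x}) = 0 := by
    have h := measure_inter_add_sdiff (μ := μ) Q (measurableSet_singleton x)
    rw [Set.inter_eq_right.2 (Set.singleton_subset_iff.2 hx)] at h
    have h1 : μ {x} = 1 := le_antisymm ((measure_mono (Set.singleton_subset_iff.2 hx)).trans hQ) hxμ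
    rw [h1] at h
    have h2 : 1 + μ (Q \ {x}) ≤ 1 + 0 := by rw [h, add_zero]; exact hQ
    exact le_zero_iff.1 ((ENNReal.add_le_add_iff_left ENNReal.one_ne_top).1 h2)
  have hxc : dist x c ≤ ε := hQc hx
  have hε : 0 ≤ ε := dist_nonneg.trans hxc
  have key : μ (closedBall x r \ {x}) = μ (closedBall c r \ Q) := by
    apply le_antisymm
    · calc μ (closedBall x r \ {x})
          ≤ μ ((closedBall c r \ Q) ∪ ((closedBall c (r + ε) \ closedBall c (r - ε)) \ Q)
              ∪ (Q \ {x})) := by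
            refine measure_mono fun y hy => ?_
            by_cases hyQ : y ∈ Q
            · exact Or.inr ⟨hyQ, hy.2⟩
            · have h1 : dist y x ≤ r := hy.1
              have h2 : dist y c ≤ r + ε := (dist_triangle y x c).trans (add_le_add h1 hxc)
              by_cases h3 : dist y c ≤ r - ε
              · exact Or.inl (Or.inl ⟨by rw [mem_closedBall]; linarith, hyQ⟩)
              · exact Or.inl (Or.inr ⟨⟨h2, h3⟩, hyQ⟩)
        _ ≤ μ (closedBall c r \ Q) + 0 + 0 := by
            refine (measure_union_le _ _).trans (add_le_add ((measure_union_le _ _).trans ?_) hQx.le)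
            exact add_le_add le_rfl hS.le
        _ = _ := by simp
    · calc μ (closedBall c r \ Q)
          ≤ μ ((closedBall x r \ {x}) ∪ ((closedBall c (r + ε) \ closedBall c (r - ε)) \ Q)) := by
            refine measure_mono fun y hy => ?_
            have h1 : dist y c ≤ r := hy.1
            by_cases h3 : dist y c ≤ r - ε
            · refine Or.inl ⟨?_, fun h => hy.2 (h ▸ hx)⟩
              have := dist_triangle_right y x c
              rw [mem_closedBall]
              linarith
            · exact Or.inr ⟨⟨by rw [mem_closedBall]; linarith, h3⟩, hy.2⟩
        _ ≤ μ (closedBall x r \ {x}) + 0 := (measure_union_le _ _).trans (add_le_add le_rfl hS.le)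
        _ = _ := by simp
  rw [natCount_neighbours, natCount, natCount, key]

/-- The sum of `g` of the number of neighbours, over the listed points in `B`. -/
noncomputable def neighbourSum (r : ℝ) (g : ℕ → ℝ≥0∞) (k : ℕ∞) (x : ℕ → Space d)
    (B : Set (Space d)) : ℝ≥0∞ :=
  ∑' i : ℕ, {i : ℕ | (i : ℕ∞) < k ∧ x i ∈ B}.indicator
    (fun i => g (neighbourCount r (x i) (pointSum k x))) i

theorem tsum_indicator_const_pointSum (k : ℕ∞) (x : ℕ → Space d) {B : Set (Space d)}
    (hB : MeasurableSet B) (a : ℝ≥0∞) :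
    ∑' i : ℕ, {i : ℕ | (i : ℕ∞) < k ∧ x i ∈ B}.indicator (fun _ => a) i
      = pointSum k x B * a := by
  rw [pointSum_apply _ _ hB, ← tsum_subtype, ENNReal.tsum_set_const]

theorem neighbourSum_le_of_cell {r ε : ℝ} {g : ℕ → ℝ≥0∞} (hg : ∀ n, g n ≤ 1)
    {k : ℕ∞} {x : ℕ → Space d} (h : IsConfiguration (pointSum k x)) {c : Space d}
    {Q : Set (Space d)} (hQ : MeasurableSet Q) (hQc : Q ⊆ closedBall c ε) :
    neighbourSum r g k x Q ≤
      natCount Q (pointSum k x) * g (natCount (closedBall c r \ Q) (pointSum k x))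
      + natCount Q (pointSum k x) *
        natCount ((closedBall c (r + ε) \ closedBall c (r - ε)) \ Q) (pointSum k x)
      + (natCount Q (pointSum k x)).descFactorial 2 := by
  have hQb : Bornology.IsBounded Q := isBounded_closedBall.subset hQc
  have hSm : MeasurableSet ((closedBall c (r + ε) \ closedBall c (r - ε)) \ Q) :=
    (measurableSet_closedBall.diff measurableSet_closedBall).diff hQ
  have hSb : Bornology.IsBounded ((closedBall c (r + ε) \ closedBall c (r - ε)) \ Q) :=
    isBounded_closedBall.subset (Set.sdiff_subset.trans Set.sdiff_subset)
  set μ := pointSum k x with hμ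
  set S := (closedBall c (r + ε) \ closedBall c (r - ε)) \ Q with hSdef
  have hcQ := h.coe_natCount hQ hQb
  have hcS := h.coe_natCount hSm hSb
  have htriv : neighbourSum r g k x Q ≤ natCount Q μ := by
    calc neighbourSum r g k x Q
        ≤ ∑' i : ℕ, {i : ℕ | (i : ℕ∞) < k ∧ x i ∈ Q}.indicator (fun _ => 1) i :=
          ENNReal.tsum_le_tsum fun i => Set.indicator_le_indicator (hg _)
      _ = natCount Q μ := by rw [tsum_indicator_const_pointSum k x hQ, mul_one, hcQ]
  by_cases hs : natCount S μ = 0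
  · by_cases hq : natCount Q μ ≤ 1
    · refine le_trans ?_ (le_add_right (le_add_right le_rfl))
      rw [hcQ, ← tsum_indicator_const_pointSum k x hQ]
      refine ENNReal.tsum_le_tsum fun i => ?_
      by_cases hi : i ∈ {i : ℕ | (i : ℕ∞) < k ∧ x i ∈ Q}
      · rw [Set.indicator_of_mem hi, Set.indicator_of_mem hi]
        refine le_of_eq (congrArg g ?_)
        refine neighbourCount_eq_of_mem_cell hQc hi.2 ?_ ?_ ?_
        · rw [pointSum_apply _ _ (measurableSet_singleton _)]
          have : 1 ≤ {j : ℕ | (j : ℕ∞) < k ∧ x j ∈ ({x i} : Set (Space d))}.encard :=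
            Set.one_le_encard_iff_nonempty.2 ⟨i, hi.1, rfl⟩
          exact_mod_cast this
        · rw [← hcQ]
          exact_mod_cast hq
        · rw [← hSdef, ← hcS, hs, Nat.cast_zero]
      · rw [Set.indicator_of_notMem hi]
        exact zero_le
    · refine htriv.trans (le_add_left ?_)
      push Not at hq
      rw [Nat.cast_le, Nat.descFactorial_succ, Nat.descFactorial_one]
      exact Nat.le_mul_of_pos_left _ (by omega)
  · refine htriv.trans (le_add_right (le_add_left ?_))
    exact_mod_cast Nat.le_mul_of_pos_right _ (Nat.pos_of_ne_zero hs)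

/-- Space is partitioned into countably many measurable cells of small diameter. -/
theorem exists_cells {ε : ℝ} (hε : 0 < ε) :
    ∃ (Q : ℕ → Set (Space d)) (c : ℕ → Space d), (∀ n, MeasurableSet (Q n)) ∧
      Pairwise (fun i j => Disjoint (Q i) (Q j)) ∧ ⋃ n, Q n = Set.univ ∧
      ∀ n, Q n ⊆ closedBall (c n) ε := by
  let c : ℕ → Space d := TopologicalSpace.denseSeq (Space d)
  refine ⟨disjointed fun n => closedBall (c n) ε, c,
    fun n => MeasurableSet.disjointed (fun _ => measurableSet_closedBall) n,
    disjoint_disjointed _, ?_, fun n => disjointed_subset _ n⟩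
  rw [iUnion_disjointed, Set.eq_univ_iff_forall]
  intro x
  obtain ⟨n, hn⟩ := (TopologicalSpace.denseRange_denseSeq (Space d)).exists_dist_lt x hε
  exact Set.mem_iUnion.2 ⟨n, hn.le⟩

/-- The volumes of a small ball and of a thin shell vanish in the limit. -/
theorem tendsto_volume_ball_add_shell (hd : 1 ≤ d) {r : ℝ} (hr : 0 < r) :
    Filter.Tendsto (fun ε : ℝ => 2 * volume (closedBall (0 : Space d) ε)
      + volume (closedBall (0 : Space d) (r + ε) \ closedBall 0 (r - ε)))
      (nhdsWithin 0 (Set.Ioi 0)) (nhds 0) := by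
  have : Nonempty (Fin d) := ⟨⟨0, hd⟩⟩
  have h1 : Filter.Tendsto (volume ∘ fun ε : ℝ => closedBall (0 : Space d) ε)
      (nhdsWithin 0 (Set.Ioi 0)) (nhds 0) := by
    have h := tendsto_measure_biInter_gt (μ := (volume : Measure (Space d)))
      (s := fun ε : ℝ => closedBall (0 : Space d) ε) (a := 0)
      (fun ε _ => measurableSet_closedBall.nullMeasurableSet)
      (fun i j _ hij => closedBall_subset_closedBall hij)
      ⟨1, one_pos, measure_closedBall_lt_top.ne⟩
    have e : volume (⋂ ε > (0 : ℝ), closedBall (0 : Space d) ε) = 0 := by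
      refine measure_mono_null (t := {0}) (fun x hx => ?_) (measure_singleton _)
      rw [Set.mem_singleton_iff, ← norm_le_zero_iff]
      refine le_of_forall_pos_le_add fun ε hε => ?_
      rw [zero_add, ← mem_closedBall_zero_iff]
      exact Set.mem_iInter₂.1 hx ε hε
    rwa [e] at h
  have h2 : Filter.Tendsto
      (volume ∘ fun ε : ℝ => closedBall (0 : Space d) (r + ε) \ closedBall 0 (r - ε))
      (nhdsWithin 0 (Set.Ioi 0)) (nhds 0) := by
    have h := tendsto_measure_biInter_gt (μ := (volume : Measure (Space d)))
      (s := fun ε : ℝ => closedBall (0 : Space d) (r + ε) \ closedBall 0 (r - ε)) (a := 0)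
      (fun ε _ => (measurableSet_closedBall.diff measurableSet_closedBall).nullMeasurableSet)
      (fun i j _ hij => Set.sdiff_subset_sdiff (closedBall_subset_closedBall (by linarith))
        (closedBall_subset_closedBall (by linarith)))
      ⟨1, one_pos, ((measure_mono Set.sdiff_subset).trans_lt measure_closedBall_lt_top).ne⟩
    have e : volume (⋂ ε > (0 : ℝ), closedBall (0 : Space d) (r + ε) \ closedBall 0 (r - ε))
        = 0 := by
      refine measure_mono_null (t := sphere 0 r) (fun x hx => ?_)
        (Measure.addHaar_sphere_of_ne_zero _ _ hr.ne')
      have hx' := Set.mem_iInter₂.1 hx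
      simp only [Set.mem_sdiff, mem_closedBall_zero_iff, not_le] at hx'
      rw [mem_sphere_zero_iff_norm]
      refine le_antisymm (le_of_forall_pos_le_add fun ε hε => (hx' ε hε).1)
        (le_of_forall_pos_le_add fun ε hε => ?_)
      linarith [(hx' ε hε).2]
    rwa [e] at h
  have := (ENNReal.Tendsto.const_mul h1 (Or.inr (by simp : (2 : ℝ≥0∞) ≠ ⊤))).add h2
  simpa using this

end Cells

section Expectation

variable {d : ℕ} {Ω : Type*} [MeasurableSpace Ω] {P : Measure Ω}
  {X : Ω → Measure (Space d)} {Λ : Measure (Space d)} [IsLocallyFiniteMeasure Λ]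

theorem IsPoissonProcess.lintegral_comp_natCount (hX : IsPoissonProcess X Λ P) {B : Set (Space d)}
    (hB : MeasurableSet B) (hb : Bornology.IsBounded B) (f : ℕ → ℝ≥0∞) :
    ∫⁻ ω, f (natCount B (X ω)) ∂P = ∫⁻ n, f n ∂(poissonMeasure (Λ B).toNNReal) := by
  rw [← (hX.hasLaw_natCount hB hb).map_eq,
    lintegral_map .of_discrete (show Measurable fun ω => natCount B (X ω) from
      (measurable_natCount hB).comp hX.measurable)]

theorem IsPoissonProcess.lintegral_descFactorial_natCount (hX : IsPoissonProcess X Λ P)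
    {B : Set (Space d)} (hB : MeasurableSet B) (hb : Bornology.IsBounded B) (j : ℕ) :
    ∫⁻ ω, ((natCount B (X ω)).descFactorial j : ℝ≥0∞) ∂P = Λ B ^ j := by
  rw [hX.lintegral_comp_natCount hB hb (fun n => (n.descFactorial j : ℝ≥0∞)),
    lintegral_descFactorial_poissonMeasure, ENNReal.coe_toNNReal hb.measure_lt_top.ne]

theorem IsPoissonProcess.lintegral_natCount (hX : IsPoissonProcess X Λ P)
    {B : Set (Space d)} (hB : MeasurableSet B) (hb : Bornology.IsBounded B) :
    ∫⁻ ω, (natCount B (X ω) : ℝ≥0∞) ∂P = Λ B := by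
  simpa using hX.lintegral_descFactorial_natCount hB hb 1

/-- Functions of the counts in disjoint sets are uncorrelated. -/
theorem IsPoissonProcess.lintegral_natCount_mul (hX : IsPoissonProcess X Λ P)
    {A B : Set (Space d)} (hA : MeasurableSet A) (hAb : Bornology.IsBounded A)
    (hB : MeasurableSet B) (hBb : Bornology.IsBounded B) (hAB : Disjoint A B) (f : ℕ → ℝ≥0∞) :
    ∫⁻ ω, natCount A (X ω) * f (natCount B (X ω)) ∂P
      = Λ A * ∫⁻ ω, f (natCount B (X ω)) ∂P := by
  have hind := hX.iIndepFun_natCount (A := ![A, B])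
    (by intro i; fin_cases i <;> assumption) (by intro i; fin_cases i <;> assumption)
    (by
      intro i j hij
      fin_cases i <;> fin_cases j
      · exact absurd rfl hij
      · exact hAB
      · exact hAB.symm
      · exact absurd rfl hij)
  have h01 : IndepFun (fun ω => natCount A (X ω)) (fun ω => natCount B (X ω)) P :=
    hind.indepFun (i := 0) (j := 1) (by decide)
  have h := h01.comp (φ := fun n : ℕ => (n : ℝ≥0∞)) (ψ := f) .of_discrete .of_discrete
  have hmA := (measurable_natCount hA).comp hX.measurable
  have hmB := (measurable_natCount hB).comp hX.measurable
  rw [← hX.lintegral_natCount hA hAb]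
  exact lintegral_mul_eq_lintegral_mul_lintegral_of_indepFun
    (Measurable.of_discrete.comp hmA) (Measurable.of_discrete.comp hmB) h

variable {κ : Ω → ℕ∞} {ξ : ℕ → Ω → Space d} {U : ℕ → Ω → ℝ}

theorem IsUniformMarking.measurable_neighbourSum_term (hU : IsUniformMarking X κ ξ U P) (r : ℝ)
    (g : ℕ → ℝ≥0∞) {B : Set (Space d)} (hB : MeasurableSet B) (i : ℕ) :
    Measurable fun ω => {i : ℕ | (i : ℕ∞) < κ ω ∧ ξ i ω ∈ B}.indicator
      (fun i => g (neighbourCount r (ξ i ω) (X ω))) i := by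
  have hs : MeasurableSet {ω | (i : ℕ∞) < κ ω ∧ ξ i ω ∈ B} :=
    (hU.measurable_card (MeasurableSet.of_discrete (s := Set.Ioi (i : ℕ∞)))).inter
      (hU.measurable_point i hB)
  exact ((measurable_from_nat (f := g)).comp (hU.measurable_neighbourCount r i)).indicator hs

theorem IsUniformMarking.neighbourSum_eq (hU : IsUniformMarking X κ ξ U P) (r : ℝ)
    (g : ℕ → ℝ≥0∞) (B : Set (Space d)) (ω : Ω) :
    neighbourSum r g (κ ω) (fun i => ξ i ω) B
      = ∑' i : ℕ, {i : ℕ | (i : ℕ∞) < κ ω ∧ ξ i ω ∈ B}.indicator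
        (fun i => g (neighbourCount r (ξ i ω) (X ω))) i := by
  rw [hU.eq_pointSum ω, neighbourSum]

theorem IsUniformMarking.measurable_neighbourSum (hU : IsUniformMarking X κ ξ U P) (r : ℝ)
    (g : ℕ → ℝ≥0∞) {B : Set (Space d)} (hB : MeasurableSet B) :
    Measurable fun ω => neighbourSum r g (κ ω) (fun i => ξ i ω) B := by
  simp_rw [hU.neighbourSum_eq r g B]
  exact Measurable.tsum fun i => hU.measurable_neighbourSum_term r g hB i

theorem volume_closedBall_eq_meanCount (lam : ℝ≥0) {r : ℝ} (hr : 0 < r) (c : Space d) :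
    (((lam • volume : Measure (Space d)) (closedBall c r)).toNNReal) = meanCount d lam r := by
  rw [toNNReal_smul_apply, Measure.addHaar_closedBall' _ _ hr.le, ENNReal.toNNReal_mul, meanCount,
    finrank_euclideanSpace_fin, ENNReal.ofReal, ENNReal.toNNReal_coe, Real.toNNReal_pow hr.le]
  ring

/-- The expected sum over the points in a small cell. -/
theorem IsUniformMarking.lintegral_neighbourSum_cell_le [IsProbabilityMeasure P] {lam : ℝ≥0}
    (hX : IsPoissonProcess X (lam • volume) P) (hU : IsUniformMarking X κ ξ U P) {r ε : ℝ}
    (hr : 0 < r) (hε : 0 ≤ ε) {g : ℕ → ℝ≥0∞} (hg : ∀ n, g n ≤ 1) {c : Space d}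
    {Q : Set (Space d)} (hQ : MeasurableSet Q) (hQc : Q ⊆ closedBall c ε) :
    ∫⁻ ω, neighbourSum r g (κ ω) (fun i => ξ i ω) Q ∂P ≤
      lam * volume Q * (∫⁻ n, g n ∂(poissonMeasure (meanCount d lam r))
        + lam * (2 * volume (closedBall (0 : Space d) ε)
          + volume (closedBall (0 : Space d) (r + ε) \ closedBall 0 (r - ε)))) := by
  have hQb : Bornology.IsBounded Q := isBounded_closedBall.subset hQc
  set A := closedBall c r \ Q with hAdef
  set S := (closedBall c (r + ε) \ closedBall c (r - ε)) \ Q with hSdef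
  have hAm : MeasurableSet A := measurableSet_closedBall.diff hQ
  have hAb : Bornology.IsBounded A := isBounded_closedBall.subset Set.sdiff_subset
  have hSm : MeasurableSet S := (measurableSet_closedBall.diff measurableSet_closedBall).diff hQ
  have hSb : Bornology.IsBounded S :=
    isBounded_closedBall.subset (Set.sdiff_subset.trans Set.sdiff_subset)
  have hsmul : ∀ B : Set (Space d), (lam • volume : Measure (Space d)) B = lam * volume B :=
    fun B => by rw [Measure.smul_apply, ENNReal.smul_def, smul_eq_mul]
  have hvQ : volume Q ≤ volume (closedBall (0 : Space d) ε) := by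
    refine (measure_mono hQc).trans (le_of_eq ?_)
    exact Measure.addHaar_closedBall_center _ _ _
  have hvS : volume S ≤ volume (closedBall (0 : Space d) (r + ε) \ closedBall 0 (r - ε)) := by
    refine (measure_mono Set.sdiff_subset).trans (le_of_eq ?_)
    rw [measure_sdiff (closedBall_subset_closedBall (by linarith))
        measurableSet_closedBall.nullMeasurableSet measure_closedBall_lt_top.ne,
      measure_sdiff (closedBall_subset_closedBall (by linarith))
        measurableSet_closedBall.nullMeasurableSet measure_closedBall_lt_top.ne,
      Measure.addHaar_closedBall_center, Measure.addHaar_closedBall_center _ c]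
  have hmc : ∀ {B : Set (Space d)}, MeasurableSet B → Measurable fun ω => natCount B (X ω) :=
    fun hB => (measurable_natCount hB).comp hX.measurable
  have hmg : ∀ {B : Set (Space d)} (f : ℕ → ℝ≥0∞), MeasurableSet B →
      Measurable fun ω => f (natCount B (X ω)) :=
    fun f hB => (measurable_from_nat (f := f)).comp (hmc hB)
  have hgA : ∫⁻ ω, g (natCount A (X ω)) ∂P
      ≤ ∫⁻ n, g n ∂(poissonMeasure (meanCount d lam r)) + lam * volume Q := by
    rw [← volume_closedBall_eq_meanCount lam hr c,
      ← hX.lintegral_comp_natCount measurableSet_closedBall isBounded_closedBall, ← hsmul,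
      ← hX.lintegral_natCount hQ hQb, ← lintegral_add_left (hmg g measurableSet_closedBall)]
    refine lintegral_mono fun ω => ?_
    by_cases h0 : natCount Q (X ω) = 0
    · have hz : X ω Q = 0 := by
        rw [← (hX.isConfiguration ω).coe_natCount hQ hQb, h0, Nat.cast_zero]
      have : natCount A (X ω) = natCount (closedBall c r) (X ω) := by
        rw [natCount, natCount, hAdef, measure_sdiff_null hz]
      simp [this, h0]
    · refine (hg _).trans (le_add_left ?_)
      exact_mod_cast Nat.one_le_iff_ne_zero.2 h0
  have hmQS : Measurable fun ω => (natCount Q (X ω) : ℝ≥0∞) * (natCount S (X ω) : ℝ≥0∞) :=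
    (hmg (fun n => (n : ℝ≥0∞)) hQ).mul (hmg (fun n => (n : ℝ≥0∞)) hSm)
  calc ∫⁻ ω, neighbourSum r g (κ ω) (fun i => ξ i ω) Q ∂P
      ≤ ∫⁻ ω, (natCount Q (X ω) * g (natCount A (X ω))
          + natCount Q (X ω) * (natCount S (X ω) : ℝ≥0∞)
          + ((natCount Q (X ω)).descFactorial 2 : ℕ)) ∂P := by
        refine lintegral_mono fun ω => ?_
        have := neighbourSum_le_of_cell (r := r) hg
          (hU.isConfiguration hX.toIsPointProcess ω) hQ hQc
        rwa [← hU.eq_pointSum ω] at this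
    _ = (lam • volume : Measure (Space d)) Q * ∫⁻ ω, g (natCount A (X ω)) ∂P
          + (lam • volume : Measure (Space d)) Q * (lam • volume : Measure (Space d)) S
          + (lam • volume : Measure (Space d)) Q ^ 2 := by
        rw [lintegral_add_right _ (hmg (fun n => (n.descFactorial 2 : ℝ≥0∞)) hQ),
          lintegral_add_right _ hmQS,
          hX.lintegral_natCount_mul hQ hQb hAm hAb disjoint_sdiff_self_right,
          hX.lintegral_natCount_mul hQ hQb hSm hSb disjoint_sdiff_self_right
            (fun n => (n : ℝ≥0∞)),
          hX.lintegral_natCount hSm hSb, hX.lintegral_descFactorial_natCount hQ hQb 2]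
    _ = lam * volume Q * (∫⁻ ω, g (natCount A (X ω)) ∂P + lam * volume S + lam * volume Q) := by
        rw [hsmul, hsmul]
        ring
    _ ≤ lam * volume Q * ((∫⁻ n, g n ∂(poissonMeasure (meanCount d lam r)) + lam * volume Q)
          + lam * volume S + lam * volume Q) := by gcongr
    _ = lam * volume Q * (∫⁻ n, g n ∂(poissonMeasure (meanCount d lam r))
          + lam * (2 * volume Q + volume S)) := by ring
    _ ≤ _ := by gcongr

/-- The Campbell–Mecke bound for sums over the points of a function of the number of
neighbours. -/
theorem IsUniformMarking.lintegral_neighbourSum_le [IsProbabilityMeasure P] (hd : 1 ≤ d)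
    {lam : ℝ≥0} (hX : IsPoissonProcess X (lam • volume) P) (hU : IsUniformMarking X κ ξ U P)
    {r : ℝ} (hr : 0 < r) {g : ℕ → ℝ≥0∞} (hg : ∀ n, g n ≤ 1) {W : Set (Space d)}
    (hW : MeasurableSet W) (hWb : Bornology.IsBounded W) :
    ∫⁻ ω, neighbourSum r g (κ ω) (fun i => ξ i ω) W ∂P ≤
      lam * volume W * ∫⁻ n, g n ∂(poissonMeasure (meanCount d lam r)) := by
  set G := ∫⁻ n, g n ∂(poissonMeasure (meanCount d lam r)) with hG
  have hbound : ∀ ε : ℝ, 0 < ε → ∫⁻ ω, neighbourSum r g (κ ω) (fun i => ξ i ω) W ∂P ≤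
      lam * volume W * (G + lam * (2 * volume (closedBall (0 : Space d) ε)
          + volume (closedBall (0 : Space d) (r + ε) \ closedBall 0 (r - ε)))) := by
    intro ε hε
    obtain ⟨Q, c, hQm, hQd, hQu, hQc⟩ := exists_cells (d := d) hε
    have hWm : ∀ n, MeasurableSet (W ∩ Q n) := fun n => hW.inter (hQm n)
    have hWd : Pairwise fun i j => Disjoint (W ∩ Q i) (W ∩ Q j) := fun i j hij =>
      (hQd hij).mono Set.inter_subset_right Set.inter_subset_right
    have hWu : W = ⋃ n, W ∩ Q n := by rw [← Set.inter_iUnion, hQu, Set.inter_univ]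
    have hsplit : ∀ ω, neighbourSum r g (κ ω) (fun i => ξ i ω) W
        = ∑' n, neighbourSum r g (κ ω) (fun i => ξ i ω) (W ∩ Q n) := by
      intro ω
      simp only [neighbourSum]
      rw [ENNReal.tsum_comm]
      refine tsum_congr fun i => ?_
      obtain ⟨n, hn⟩ := Set.mem_iUnion.1 (hQu ▸ Set.mem_univ (ξ i ω))
      rw [tsum_eq_single n]
      · by_cases hi : (i : ℕ∞) < κ ω ∧ ξ i ω ∈ W
        · rw [Set.indicator_of_mem (s := {i : ℕ | (i : ℕ∞) < κ ω ∧ ξ i ω ∈ W}) hi,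
            Set.indicator_of_mem (s := {i : ℕ | (i : ℕ∞) < κ ω ∧ ξ i ω ∈ W ∩ Q n})
              ⟨hi.1, hi.2, hn⟩]
        · rw [Set.indicator_of_notMem (s := {i : ℕ | (i : ℕ∞) < κ ω ∧ ξ i ω ∈ W}) hi,
            Set.indicator_of_notMem (s := {i : ℕ | (i : ℕ∞) < κ ω ∧ ξ i ω ∈ W ∩ Q n})
              fun h => hi ⟨h.1, h.2.1⟩]
      · intro l hl
        refine Set.indicator_of_notMem (fun h => ?_) _
        exact Set.disjoint_left.1 (hQd hl) h.2.2 hn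
    simp_rw [hsplit]
    rw [lintegral_tsum fun n => (hU.measurable_neighbourSum r g (hWm n)).aemeasurable]
    refine (ENNReal.tsum_le_tsum fun n => hU.lintegral_neighbourSum_cell_le hX hr hε.le hg
      (hWm n) (Set.inter_subset_right.trans (hQc n))).trans (le_of_eq ?_)
    rw [ENNReal.tsum_mul_right, ENNReal.tsum_mul_left, ← measure_iUnion hWd hWm, ← hWu]
  have hlim : Filter.Tendsto (fun ε : ℝ => lam * volume W *
      (G + lam * (2 * volume (closedBall (0 : Space d) ε)
          + volume (closedBall (0 : Space d) (r + ε) \ closedBall 0 (r - ε)))))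
      (nhdsWithin 0 (Set.Ioi 0)) (nhds (lam * volume W * (G + lam * 0))) := by
    refine ENNReal.Tendsto.const_mul (Filter.Tendsto.const_add _ ?_)
      (Or.inr (ENNReal.mul_ne_top ENNReal.coe_ne_top hWb.measure_lt_top.ne))
    exact ENNReal.Tendsto.const_mul (tendsto_volume_ball_add_shell hd hr)
      (Or.inr ENNReal.coe_ne_top)
  rw [mul_zero, add_zero] at hlim
  exact ge_of_tendsto hlim (eventually_mem_nhdsWithin.mono fun ε hε => hbound ε hε)

end Expectation

section Discrepancy

variable {d : ℕ} {Ω : Type*} {X : Ω → Measure (Space d)} {κ : Ω → ℕ∞} {ξ : ℕ → Ω → Space d}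
  {U : ℕ → Ω → ℝ}

/-- The event that the mark of the `i`-th point, if it is in `W`, decides differently for the two
thinnings. -/
def discrepancy (r : ℝ) (p : ℕ → ℝ) (m : ℝ) (X : Ω → Measure (Space d)) (κ : Ω → ℕ∞)
    (ξ : ℕ → Ω → Space d) (U : ℕ → Ω → ℝ) (W : Set (Space d)) (i : ℕ) : Set Ω :=
  {ω | ((i : ℕ∞) < κ ω ∧ ξ i ω ∈ W) ∧ U i ω ∈ Set.uIoc (p (neighbourCount r (ξ i ω) (X ω))) m}

theorem restrict_neighbourThinning_eq {r : ℝ} {p : ℕ → ℝ} {m : ℝ} {W : Set (Space d)}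
    (hW : MeasurableSet W) {ω : Ω} (hω : ω ∉ ⋃ i, discrepancy r p m X κ ξ U W i) :
    (neighbourThinning r p X κ ξ U ω).restrict W
      = (independentThinning m κ ξ U ω).restrict W := by
  refine restrict_thinning_congr hW fun i hi hxi => ?_
  have h : ¬ U i ω ∈ Set.uIoc (p (neighbourCount r (ξ i ω) (X ω))) m := fun hu =>
    hω (Set.mem_iUnion.2 ⟨i, ⟨hi, hxi⟩, hu⟩)
  rw [Set.mem_uIoc] at h
  push Not at h
  constructor
  · intro h1
    by_contra h2
    exact absurd (h.2 (not_le.1 h2)) (not_lt.2 h1)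
  · intro h1
    by_contra h2
    exact absurd (h.1 (not_le.1 h2)) (not_lt.2 h1)

end Discrepancy

section TotalVariation

variable {d : ℕ} {Ω : Type*} [MeasurableSpace Ω] {P : Measure Ω}
  {X : Ω → Measure (Space d)} {κ : Ω → ℕ∞} {ξ : ℕ → Ω → Space d} {U : ℕ → Ω → ℝ}

theorem measurable_restrict_measure {W : Set (Space d)} (hW : MeasurableSet W) :
    Measurable fun μ : Measure (Space d) => μ.restrict W := by
  refine Measure.measurable_of_measurable_coe _ fun B hB => ?_
  simp_rw [Measure.restrict_apply hB]
  exact Measure.measurable_coe (hB.inter hW)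

/-- The coupling inequality. -/
theorem tvDist_map_le_of_eq_on_compl {M : Type*} [MeasurableSpace M] [IsProbabilityMeasure P]
    {Y Z : Ω → M} (hY : Measurable Y) (hZ : Measurable Z) {D : Set Ω}
    (h : ∀ ω, ω ∉ D → Y ω = Z ω) : tvDist (P.map Y) (P.map Z) ≤ P.real D := by
  have : Nonempty {A : Set M // MeasurableSet A} := ⟨⟨∅, .empty⟩⟩
  refine ciSup_le fun A => ?_
  rw [map_measureReal_apply hY A.2, map_measureReal_apply hZ A.2]
  have key : ∀ {Y Z : Ω → M}, (∀ ω, ω ∉ D → Y ω = Z ω) →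
      P.real (Y ⁻¹' A.1) ≤ P.real (Z ⁻¹' A.1) + P.real D := fun {Y Z} h => by
    refine (measureReal_mono fun ω hω => ?_).trans (measureReal_union_le (Z ⁻¹' A.1) D)
    by_cases hD : ω ∈ D
    · exact Or.inr hD
    · exact Or.inl (by rw [Set.mem_preimage, ← h ω hD]; exact hω)
  rw [abs_sub_le_iff]
  exact ⟨by linarith [key h], by linarith [key fun ω hω => (h ω hω).symm]⟩

theorem IsUniformMarking.measure_mark_mem_uIoc (hU : IsUniformMarking X κ ξ U P) (i : ℕ) {a b : ℝ}
    (ha : a ∈ Set.Icc (0 : ℝ) 1) (hb : b ∈ Set.Icc (0 : ℝ) 1) :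
    P {ω | U i ω ∈ Set.uIoc a b} = ENNReal.ofReal |a - b| := by
  rw [Set.uIoc, hU.measure_mark_mem_Ioc i (le_inf ha.1 hb.1) (sup_le ha.2 hb.2),
    max_sub_min_eq_abs']

theorem IsUniformMarking.measure_discrepancy [IsProbabilityMeasure P]
    (hU : IsUniformMarking X κ ξ U P) (r : ℝ) {p : ℕ → ℝ} (hp : ∀ n, p n ∈ Set.Icc (0 : ℝ) 1)
    {m : ℝ} (hm : m ∈ Set.Icc (0 : ℝ) 1) {W : Set (Space d)} (hW : MeasurableSet W) (i : ℕ) :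
    P (discrepancy r p m X κ ξ U W i)
      = ∫⁻ ω, {i : ℕ | (i : ℕ∞) < κ ω ∧ ξ i ω ∈ W}.indicator
          (fun i => ENNReal.ofReal |p (neighbourCount r (ξ i ω) (X ω)) - m|) i ∂P := by
  let N : ℕ∞ × (ℕ → Space d) → ℝ := fun z => p (neighbourCount r (z.2 i) (pointSum z.1 z.2))
  have hN : Measurable N :=
    (measurable_from_nat (f := p)).comp (measurable_neighbourCount_pointSum r i)
  let E : Set (ℝ × (ℕ∞ × (ℕ → Space d))) :=
    {z | ((i : ℕ∞) < z.2.1 ∧ z.2.2 i ∈ W) ∧ z.1 ∈ Set.uIoc (N z.2) m}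
  have hk : Measurable fun z : ℝ × (ℕ∞ × (ℕ → Space d)) => z.2.1 := by fun_prop
  have hx : Measurable fun z : ℝ × (ℕ∞ × (ℕ → Space d)) => z.2.2 i := by fun_prop
  have hN2 : Measurable fun z : ℝ × (ℕ∞ × (ℕ → Space d)) => N z.2 := hN.comp measurable_snd
  have hE : MeasurableSet E :=
    ((hk (MeasurableSet.of_discrete (s := Set.Ioi (i : ℕ∞)))).inter (hx hW)).inter
      ((measurableSet_lt (hN2.min measurable_const) measurable_fst).inter
        (measurableSet_le measurable_fst (hN2.max measurable_const)))
  have hNω : ∀ ω, N (κ ω, fun i => ξ i ω) = p (neighbourCount r (ξ i ω) (X ω)) := fun ω => by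
    rw [hU.eq_pointSum ω]
  have hDm : discrepancy r p m X κ ξ U W i
      = (fun ω => (U i ω, (κ ω, fun i => ξ i ω))) ⁻¹' E := by
    ext ω
    simp only [discrepancy, E, Set.mem_preimage, Set.mem_ofPred_eq, hNω]
  have hind : IndepFun (U i) (fun ω => (κ ω, fun i => ξ i ω)) P :=
    hU.indepFun.comp (φ := fun u : ℕ → ℝ => u i) (ψ := id) (measurable_pi_apply i) measurable_id
  have hfub := lintegral_eq_lintegral_lintegral_of_indepFun hind (hU.measurable_mark i)
    hU.measurable_list (F := E.indicator 1) (measurable_one.indicator hE)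
  have hleft : ∫⁻ ω, E.indicator 1 (U i ω, (κ ω, fun i => ξ i ω)) ∂P
      = P (discrepancy r p m X κ ξ U W i) := by
    rw [hDm, ← lintegral_indicator_one
      (((hU.measurable_mark i).prodMk hU.measurable_list) hE)]
    rfl
  rw [← hleft, hfub]
  refine lintegral_congr fun ω => ?_
  by_cases hi : (i : ℕ∞) < κ ω ∧ ξ i ω ∈ W
  · rw [Set.indicator_of_mem (show i ∈ {i : ℕ | (i : ℕ∞) < κ ω ∧ ξ i ω ∈ W} from hi),
      ← hU.measure_mark_mem_uIoc i (hp _) hm, ← lintegral_indicator_one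
        (show MeasurableSet {ω' | U i ω' ∈ Set.uIoc (p (neighbourCount r (ξ i ω) (X ω))) m} from
          hU.measurable_mark i measurableSet_uIoc)]
    refine lintegral_congr fun ω' => ?_
    by_cases hu : U i ω' ∈ Set.uIoc (p (neighbourCount r (ξ i ω) (X ω))) m
    · have hmem : (U i ω', (κ ω, fun i => ξ i ω)) ∈ E := ⟨hi, (hNω ω).symm ▸ hu⟩
      exact (Set.indicator_of_mem hmem 1).trans (Set.indicator_of_mem
        (s := {ω' | U i ω' ∈ Set.uIoc (p (neighbourCount r (ξ i ω) (X ω))) m}) hu 1).symm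
    · have hmem : (U i ω', (κ ω, fun i => ξ i ω)) ∉ E := fun h => hu (hNω ω ▸ h.2)
      exact (Set.indicator_of_notMem hmem 1).trans (Set.indicator_of_notMem
        (s := {ω' | U i ω' ∈ Set.uIoc (p (neighbourCount r (ξ i ω) (X ω))) m}) hu 1).symm
  · rw [Set.indicator_of_notMem (show i ∉ {i : ℕ | (i : ℕ∞) < κ ω ∧ ξ i ω ∈ W} from hi)]
    have : ∀ ω', E.indicator (1 : ℝ × (ℕ∞ × (ℕ → Space d)) → ℝ≥0∞) (U i ω', (κ ω, fun i => ξ i ω))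
        = 0 := fun ω' =>
      Set.indicator_of_notMem (fun h => hi h.1) _
    simp_rw [this, lintegral_zero]

theorem meanRetention_mem_Icc {p : ℕ → ℝ} (hp : ∀ n, p n ∈ Set.Icc (0 : ℝ) 1) (μ : ℝ≥0) :
    meanRetention p μ ∈ Set.Icc (0 : ℝ) 1 := by
  refine ⟨integral_nonneg fun n => (hp n).1, ?_⟩
  have hintg : Integrable p (poissonMeasure μ) := .of_bound .of_discrete 1
    (.of_forall fun n => by rw [Real.norm_of_nonneg (hp n).1]; exact (hp n).2)
  calc meanRetention p μ ≤ ∫ _, (1 : ℝ) ∂(poissonMeasure μ) :=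
        integral_mono hintg (integrable_const _) fun n => (hp n).2
    _ = 1 := by simp

/-- The total variation distance between the two thinnings in a bounded window. -/
theorem IsUniformMarking.tvDist_windowLaw_le [IsProbabilityMeasure P] (hd : 1 ≤ d)
    {lam : ℝ≥0} (hX : IsPoissonProcess X (lam • volume) P) (hU : IsUniformMarking X κ ξ U P)
    {r : ℝ} (hr : 0 < r) {p : ℕ → ℝ} (hp : ∀ n, p n ∈ Set.Icc (0 : ℝ) 1) {m : ℝ}
    (hm : m ∈ Set.Icc (0 : ℝ) 1) {W : Set (Space d)} (hW : MeasurableSet W)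
    (hWb : Bornology.IsBounded W) :
    tvDist (windowLaw P (neighbourThinning r p X κ ξ U) W)
        (windowLaw P (independentThinning m κ ξ U) W) ≤
      lam * volume.real W * ∫ n, |p n - m| ∂(poissonMeasure (meanCount d lam r)) := by
  have hmT := (hU.isPointProcess_neighbourThinning hX.toIsPointProcess r p).measurable
  have hmI := (hU.isPointProcess_independentThinning hX.toIsPointProcess m).measurable
  have hle : ∀ n, |p n - m| ≤ 1 := fun n => by
    rw [abs_le]
    constructor <;> linarith [(hp n).1, (hp n).2, hm.1, hm.2]
  have hbound : P (⋃ i, discrepancy r p m X κ ξ U W i) ≤ ENNReal.ofReal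
      (lam * volume.real W * ∫ n, |p n - m| ∂(poissonMeasure (meanCount d lam r))) := by
    have hintg : Integrable (fun n => |p n - m|) (poissonMeasure (meanCount d lam r)) :=
      .of_bound .of_discrete 1 (.of_forall fun n => by rw [norm_abs_eq_norm]; exact hle n)
    calc P (⋃ i, discrepancy r p m X κ ξ U W i)
        ≤ ∑' i, P (discrepancy r p m X κ ξ U W i) := measure_iUnion_le _
      _ = ∫⁻ ω, neighbourSum r (fun n => ENNReal.ofReal |p n - m|) (κ ω) (fun i => ξ i ω) W ∂P := by
          simp_rw [hU.measure_discrepancy r hp hm hW, hU.neighbourSum_eq]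
          exact (lintegral_tsum fun i => (hU.measurable_neighbourSum_term r
            (fun n => ENNReal.ofReal |p n - m|) hW i).aemeasurable).symm
      _ ≤ lam * volume W *
          ∫⁻ n, ENNReal.ofReal |p n - m| ∂(poissonMeasure (meanCount d lam r)) :=
          hU.lintegral_neighbourSum_le hd hX hr
            (fun n => ENNReal.ofReal_le_one.2 (hle n)) hW hWb
      _ = _ := by
          rw [← ofReal_integral_eq_lintegral_ofReal hintg (.of_forall fun n => abs_nonneg _),
            ENNReal.ofReal_mul (by positivity), ENNReal.ofReal_mul (by positivity),
            ENNReal.ofReal_coe_nnreal, ofReal_measureReal hWb.measure_lt_top.ne]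
  refine (tvDist_map_le_of_eq_on_compl ((measurable_restrict_measure hW).comp hmT)
    ((measurable_restrict_measure hW).comp hmI)
    fun ω hω => restrict_neighbourThinning_eq hW hω).trans ?_
  exact ENNReal.toReal_le_of_le_ofReal
    (mul_nonneg (by positivity) (integral_nonneg fun n => abs_nonneg _)) hbound

end TotalVariation

end NeighbourThinning

open NeighbourThinning

theorem mainTheorem3 {d : ℕ} (hd : 1 ≤ d)
    {Ω : Type*} [MeasurableSpace Ω] (P : Measure Ω) [IsProbabilityMeasure P]
    (lam : ℝ≥0) (r : ℝ) (hr : 0 < r)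
    (p : ℕ → ℝ) (hp : ∀ n, p n ∈ Set.Icc (0 : ℝ) 1)
    (X : Ω → Measure (Space d))
    (hX : IsPoissonProcess X (lam • volume) P)
    (κ : Ω → ℕ∞) (ξ : ℕ → Ω → Space d) (U : ℕ → Ω → ℝ)
    (hU : IsUniformMarking X κ ξ U P)
    (μ : ℝ≥0) (hμ : μ = meanCount d lam r)
    (m : ℝ) (hm : m = meanRetention p μ) :
    IsPointProcess (neighbourThinning r p X κ ξ U) ∧
    IsPoissonProcess (independentThinning m κ ξ U)
      ((lam * m.toNNReal) • volume) P ∧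
    ∀ W : Set (Space d), MeasurableSet W → Bornology.IsBounded W →
      tvDist
          (windowLaw P (neighbourThinning r p X κ ξ U) W)
          (windowLaw P (independentThinning m κ ξ U) W) ≤
        lam * volume.real W * ∫ n, |p n - m| ∂(poissonMeasure μ) := by
  have hmI : m ∈ Set.Icc (0 : ℝ) 1 := hm ▸ meanRetention_mem_Icc hp μ
  refine ⟨hU.isPointProcess_neighbourThinning hX.toIsPointProcess r p,
    hU.isPoissonProcess_independentThinning hX hmI, fun W hW hWb => ?_⟩
  rw [hμ]
  exact hU.tvDist_windowLaw_le hd hX hr hp hmI hW hWb
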